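/- \textbf{Setting.} Let $M=(\mathcal S,\mathcal A,\mathcal P,c,\gamma)$ be a finite discounted Markov decision process, $\gamma\in(0,1)$, with policies $\pi(\cdot|s)\in\Delta_{|\mathcal A|}$. For $p,q\in\Delta_{|\mathcal A|}$ with $q>0$ let $D_q^p=\sum_a p(a)\log\frac{p(a)}{q(a)}$. For each state $s$ let $h^p(s)$ be a continuous convex function of $p\in\Delta_{|\mathcal A|}$, differentiable at strictly positive $p$, such that, for some $\mu>0$, $h^{p}(s)-h^{p'}(s)-\langle\nabla h^{p'}(s,\cdot),p-p'\rangle\ge\mu D_{p'}^{p}$ for all $p\in\Delta_{|\mathcal A|}$ and all strictly positive $p'\in\Delta_{|\mathcal A|}$. Let $V^\pi(s)$ and $Q^\pi(s,a)$ be the expected values of $\sum_{t\ge0}\gamma^t[c(s_t,a_t)+h^{\pi}(s_t)]$ under $\pi$ given $s_0=s$, respectively $(s_0,a_0)=(s,a)$. Let $\pi^*$ minimize $V^\pi(s)$ simultaneously for all $s$, let $\nu^*$ be a stationary distribution of the chain induced by $\pi^*$, and put $f(\pi)=\mathbb E_{s\sim\nu^*}[V^\pi(s)]$, $\mathcal D(\pi,\pi^*)=\mathbb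 E_{s\sim\nu^*}[D_{\pi(\cdot|s)}^{\pi^*(\cdot|s)}]$. Put $$\eta=\tfrac{1-\gamma}{\gamma\mu},\quad l=\lceil\log_\gamma\tfrac14\rceil,\quad m=1+\mu\eta,\quad L\ge0,\quad \Lambda=4\max\{\eta L,m\},\quad \kappa=\max\{1,\tfrac{(1-\gamma)L}{\mu}\}.$$ \textbf{Algorithm (inexact SPMD).} Let $\pi_0=v_0$ be the uniform policy. In iteration $k$, given an estimator $\mathcal Q^{\pi_k,\xi_k}$ of $Q^{\pi_k}$, apply for each state $s$ $T_k\ge1$ accelerated gradient iterations with $x_0=y_0=\pi_0(\cdot|s)$ to $\min_{p\in\Delta_{|\mathcal A|}}\{\phi(p)+\chi(p)\}$, where $\phi(p)=\eta[\langle\mathcal Q^{\pi_k,\xi_k}(s,\cdot),p\rangle+h^p(s)]$ and $\chi(p)=D_{v_k(\cdot|s)}^p$: $$\underline x_t=(1-\rho_t)y_{t-1}+\rho_tx_{t-1},\quad x_t=\arg\min_{p\in\Delta_{|\mathcal A|}}\{r_t[\langle\nabla\phi(\underline x_t),p\rangle+\mu\eta D_{\underline x_t}^p+\chi(p)]+D_{x_{t-1}}^p\},\quad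 y_t=(1-\rho_t)y_{t-1}+\rho_tx_t,$$ with $\rho_t=\frac2{t+1}$, $r_t=\frac t{2\Lambda}$ for $t\le\lfloor2\sqrt{\Lambda/m}-1\rfloor$ and $\rho_t=\sqrt{m/\Lambda}$, $r_t=\frac1{\sqrt{\Lambda m}-m}$ otherwise; then $(\pi_{k+1},v_{k+1})=(y_{T_k},x_{T_k})$. Put $\varepsilon(t)=2\Lambda\min\{(1-\sqrt{m/\Lambda})^{t-1},\frac2{t(t+1)}\}$ for $t\ge 1$. Assume that $\nabla h^{p}(s,\cdot)$ is $L$-Lipschitz (from $\|\cdot\|_1$ to $\|\cdot\|_\infty$) on some convex set of strictly positive $p$ that almost surely contains all the inner iterates $x_t,y_t$ at state $s$, and that for all $k\ge0$, conditionally on $\xi_0,\dots,\xi_{k-1}$, the $\ell_\infty$ bias of $\mathcal Q^{\pi_k,\xi_k}$ is at most $\varsigma_k=(1-\gamma)2^{-(\lfloor k/l\rfloor+2)}$ and $\mathbb E\|\mathcal Q^{\pi_k,\xi_k}-Q^{\pi_k}\|_\infty^2\le\sigma_k^2=2^{-(\lfloor k/l\rfloor+2)}$. \textbf{Theorem.}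 (a) Suppose $\varepsilon_k:=\varepsilon(T_k)\le(1-\gamma)^2 2^{-(\lfloor (k+1)/l\rfloor+2)}$ for all $k\ge0$. Put $$B=f(\pi_0)-f(\pi^*)+\tfrac1{1-\gamma}\Big(\mu\log|\mathcal A|+\tfrac{5(2-\gamma)}2+\tfrac5{8\gamma\mu}+\tfrac{5\mu\gamma^2(1+\gamma)\log|\mathcal A|}4\Big).$$ Then for every $k\ge0$ (all the random variables being integrable) $$\mathbb E\big[f(\pi_k)-f(\pi^*)+\tfrac\mu{1-\gamma}\mathcal D(v_k,\pi^*)\big]\le2^{-\lfloor k/l\rfloor}B,$$ $$\mathbb E\big[f(\pi_k)-f(\pi^*)+\tfrac\mu{1-\gamma}\mathcal D(\pi_k,\pi^*)\big]\le20(1+\log\kappa)\,2^{-\lfloor k/l\rfloor}B .$$ In particular, for every $\epsilon>0$, with $n(\epsilon)=\max\{0,\lceil\log_2(B/\epsilon)\rceil\}$, one has $\mathbb E[f(\pi_{k})-f(\pi^*)]\le\epsilon$ for $k=l\,n(\epsilon)$. (b) The least $T_k\ge1$ satisfying the condition in (a) exist, and with them the number $N(\epsilon)=\sum_{k<l\,n(\epsilon)}T_k$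 of evaluations of $\nabla h$ per state needed for this satisfies, for every $\epsilon>0$, $$N(\epsilon)\le20\,l\,n(\epsilon)\sqrt{\kappa}\,\Big(n(\epsilon)+\log\tfrac{\kappa}{\gamma(1-\gamma)^2}\Big),$$ and, with all the problem data fixed, $N(\epsilon)=O\big((\log_\gamma\epsilon)\sqrt{\kappa}\,\log(1/\epsilon)\big)$ as $\epsilon\downarrow0$. -/

import Mathlib

open MeasureTheory Filter Topology

noncomputable section

namespace PMD

/-- A finite discounted Markov decision process: transition probabilities `P s a s'` (of moving to
`s'` from `s` under action `a`), costs `c s a`, and a discount factor `γ` in `(0,1)`. -/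
structure MDP (S A : Type*) [Fintype S] where
  P : S → A → S → ℝ
  c : S → A → ℝ
  γ : ℝ
  P_mem : ∀ s a, P s a ∈ stdSimplex ℝ S
  γ_pos : 0 < γ
  γ_lt_one : γ < 1

section Basic

variable {S A : Type*} [Fintype S] [Fintype A]

/-- A policy: `π s` is a probability vector over the actions for every state `s`. -/
def IsPolicy (π : S → A → ℝ) : Prop := ∀ s, π s ∈ stdSimplex ℝ A

/-- The inner product over the action space. -/
def pair (g p : A → ℝ) : ℝ := ∑ a, g a * p a

/-- `p ↦ ⟨g, p⟩` as a continuous linear functional. -/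
def pairCLM (g : A → ℝ) : (A → ℝ) →L[ℝ] ℝ :=
  ∑ a, g a • ContinuousLinearMap.proj (R := ℝ) (φ := fun _ : A => ℝ) a

/-- The Bregman distance `D_q^p` of the negative entropy on the simplex, that is, the
Kullback--Leibler divergence of `p` relative to `q` (used only for strictly positive `q`). -/
def KL (p q : A → ℝ) : ℝ := ∑ a, p a * Real.log (p a / q a)

/-- The `ℓ₁` distance. -/
def l1dist (p q : A → ℝ) : ℝ := ∑ a, |p a - q a|

/-- The relative interior of the simplex: the strictly positive probability vectors. -/
def posSimplex (A : Type*) [Fintype A] : Set (A → ℝ) := {p | p ∈ stdSimplex ℝ A ∧ ∀ a, 0 < p a}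

/-- The uniform policy. -/
def uniformPolicy (S A : Type*) [Fintype A] : S → A → ℝ := fun _ _ => 1 / (Fintype.card A : ℝ)

/-- One step of the Markov chain of policy `π`, acting on functions:
`(stepOp M π g) s = 𝔼[g(s₁) | s₀ = s, a₀ ∼ π(·|s₀), s₁ ∼ P(·|s₀,a₀)]`. -/
def stepOp (M : MDP S A) (π : S → A → ℝ) (g : S → ℝ) : S → ℝ :=
  fun s => ∑ a, π s a * ∑ s', M.P s a s' * g s'

/-- `𝔼[c(s,a) + h^π(s) | a ∼ π(·|s)]`. -/
def stageCost (M : MDP S A) (h : S → (A → ℝ) → ℝ) (π : S → A → ℝ) : S → ℝ :=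
  fun s => ∑ a, π s a * M.c s a + h s (π s)

/-- The state-value function
`V^π(s) = 𝔼[∑ₜ γᵗ (c(sₜ,aₜ) + h^π(sₜ)) | s₀ = s, aₜ ∼ π(·|sₜ), sₜ₊₁ ∼ P(·|sₜ,aₜ)]`;
`(stepOp M π)^[t] g s` is `𝔼[g(sₜ) | s₀ = s]`. -/
def V (M : MDP S A) (h : S → (A → ℝ) → ℝ) (π : S → A → ℝ) (s : S) : ℝ :=
  ∑' t : ℕ, M.γ ^ t * (stepOp M π)^[t] (stageCost M h π) s

/-- The action-value function
`Q^π(s,a) = 𝔼[∑ₜ γᵗ (c(sₜ,aₜ) + h^π(sₜ)) | s₀ = s, a₀ = a, aₜ ∼ π(·|sₜ), sₜ₊₁ ∼ P(·|sₜ,aₜ)]`. -/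
def Q (M : MDP S A) (h : S → (A → ℝ) → ℝ) (π : S → A → ℝ) (s : S) (a : A) : ℝ :=
  M.c s a + h s (π s) +
    ∑' t : ℕ, M.γ ^ (t + 1) * ∑ s', M.P s a s' * (stepOp M π)^[t] (stageCost M h π) s'

/-- An optimal policy: it minimizes the value simultaneously at all states. -/
def IsOptimal (M : MDP S A) (h : S → (A → ℝ) → ℝ) (πs : S → A → ℝ) : Prop :=
  IsPolicy πs ∧ ∀ π : S → A → ℝ, IsPolicy π → ∀ s, V M h πs s ≤ V M h π s

/-- A stationary state distribution of the Markov chain induced by `π`. -/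
def IsStationary (M : MDP S A) (π : S → A → ℝ) (ν : S → ℝ) : Prop :=
  ν ∈ stdSimplex ℝ S ∧ ∀ s', ∑ s, ν s * ∑ a, π s a * M.P s a s' = ν s'

/-- The objective `f(π) = 𝔼_{s ∼ ν}[V^π(s)]`. -/
def objective (M : MDP S A) (h : S → (A → ℝ) → ℝ) (ν : S → ℝ) (π : S → A → ℝ) : ℝ :=
  ∑ s, ν s * V M h π s

/-- `𝒟(π, π*) = 𝔼_{s ∼ ν}[D_π^{π*}(s)]`. -/
def avgDist (ν : S → ℝ) (π πs : S → A → ℝ) : ℝ := ∑ s, ν s * KL (πs s) (π s)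

/-- `h` (a function of the state and of the action distribution at that state) is a `μ`-strongly
convex regularizer with gradient `g`: it is continuous and convex on the simplex, differentiable at
the strictly positive points, and
`h(p) - [h(p') + ⟨∇h(p'), p - p'⟩] ≥ μ D_{p'}^p`. -/
structure IsStronglyConvexReg (h : S → (A → ℝ) → ℝ) (g : S → (A → ℝ) → (A → ℝ)) (μ : ℝ) :
    Prop where
  continuousOn : ∀ s, ContinuousOn (h s) (stdSimplex ℝ A)
  convexOn : ∀ s, ConvexOn ℝ (stdSimplex ℝ A) (h s)
  hasGradient : ∀ s, ∀ p ∈ posSimplex A,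
    HasFDerivWithinAt (h s) (pairCLM (g s p)) (stdSimplex ℝ A) p
  strong : ∀ s, ∀ p ∈ stdSimplex ℝ A, ∀ p' ∈ posSimplex A,
    μ * KL p p' ≤ h s p - (h s p' + pair (g s p') (p - p'))

/-- `R s` is a convex set of strictly positive action distributions on which the gradient of `h(s)`
is `L`-Lipschitz (from the `ℓ₁` norm to its dual, the `ℓ_∞` norm). -/
structure IsSmoothOn (g : S → (A → ℝ) → (A → ℝ)) (L : ℝ) (R : S → Set (A → ℝ)) : Prop where
  subset : ∀ s, R s ⊆ posSimplex A
  convex : ∀ s, Convex ℝ (R s)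
  lipschitz : ∀ s, ∀ p ∈ R s, ∀ p' ∈ R s, ∀ a, |g s p a - g s p' a| ≤ L * l1dist p p'

/-! ### Accelerated gradient descent on the simplex -/

/-- `T` iterations of accelerated gradient descent with parameters `q, r, ρ`, started at
`x₀ = y₀ = start`, for `min_{p ∈ Δ} φ(p) + χ(p)`, where `gφ` is the gradient of `φ` and `φ` is
`μφ`-strongly convex relative to `D`. Iteration `t` evaluates `gφ` once, at the point `x̲ₜ`. -/
structure IsAGD (gφ : (A → ℝ) → (A → ℝ)) (μφ : ℝ) (χ : (A → ℝ) → ℝ) (q r ρ : ℕ → ℝ)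
    (start : A → ℝ) (T : ℕ) (x y : ℕ → A → ℝ) : Prop where
  x_zero : x 0 = start
  y_zero : y 0 = start
  x_mem : ∀ t < T, x (t + 1) ∈ stdSimplex ℝ A
  x_step : ∀ t < T, ∀ z : A → ℝ, z = (1 - q (t + 1)) • y t + q (t + 1) • x t →
    IsMinOn (fun p => r (t + 1) * (pair (gφ z) p + μφ * KL p z + χ p) + KL p (x t))
      (stdSimplex ℝ A) (x (t + 1))
  y_step : ∀ t < T, y (t + 1) = (1 - ρ (t + 1)) • y t + ρ (t + 1) • x (t + 1)

end Basic

/-- The switching index `t₀ = ⌊2 √(Λ/m) - 1⌋`, for smoothness parameter `Λ` and total strong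
convexity modulus `m`. -/
def agdSwitch (Λ m : ℝ) : ℕ := ⌊2 * Real.sqrt (Λ / m) - 1⌋₊

/-- The averaging weights `ρₜ` (also used as `qₜ`). -/
def agdWeight (Λ m : ℝ) (t : ℕ) : ℝ :=
  if t ≤ agdSwitch Λ m then 2 / ((t : ℝ) + 1) else Real.sqrt (m / Λ)

/-- The step sizes `rₜ`. -/
def agdStepsize (Λ m : ℝ) (t : ℕ) : ℝ :=
  if t ≤ agdSwitch Λ m then (t : ℝ) / (2 * Λ) else 1 / (Real.sqrt (Λ * m) - m)

/-- The accuracy `ε(t) = 2 Λ min {(1 - √(m/Λ))^(t-1), 2/(t(t+1))}` after `t ≥ 1` iterations. -/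
def agdAccuracy (Λ m : ℝ) (t : ℕ) : ℝ :=
  2 * Λ * min ((1 - Real.sqrt (m / Λ)) ^ (t - 1)) (2 / ((t : ℝ) * ((t : ℝ) + 1)))

/-! ### Parameters of the stochastic policy mirror descent method -/

/-- The stepsize `η = (1-γ)/(γ μ)`. -/
def stepsize (γ μ : ℝ) : ℝ := (1 - γ) / (γ * μ)

/-- `l = ⌈log_γ (1/4)⌉`. -/
def epochLen (γ : ℝ) : ℕ := ⌈Real.logb γ (1 / 4)⌉₊

/-- `2^{-(⌊k/l⌋ + 2)}`. -/
def decay (γ : ℝ) (k : ℕ) : ℝ := (1 / 2 : ℝ) ^ (k / epochLen γ + 2)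

/-- The modulus `1 + μ η` of the subproblems. -/
def subModulus (γ μ : ℝ) : ℝ := 1 + stepsize γ μ * μ

/-- The smoothness parameter `4 max {η L, 1 + μ η}` given to the accelerated gradient method. -/
def subSmooth (γ μ L : ℝ) : ℝ := 4 * max (stepsize γ μ * L) (subModulus γ μ)

/-- The numbers `T k ≥ 1` of inner iterations reach the accuracies
`ε_k = ε(T_k) ≤ (1-γ)² 2^{-(⌊(k+1)/l⌋ + 2)}`. -/
def AdmissibleSteps (γ μ L : ℝ) (T : ℕ → ℕ) : Prop :=
  ∀ k, 1 ≤ T k ∧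
    agdAccuracy (subSmooth γ μ L) (subModulus γ μ) (T k) ≤ (1 - γ) ^ 2 * decay γ (k + 1)

/-- The least admissible number of inner iterations at outer iteration `k`. -/
def leastSteps (γ μ L : ℝ) (k : ℕ) : ℕ :=
  sInf {t : ℕ | 1 ≤ t ∧
    agdAccuracy (subSmooth γ μ L) (subModulus γ μ) t ≤ (1 - γ) ^ 2 * decay γ (k + 1)}

/-- `max {1, (1-γ)L/μ}`; here `(1-γ)L/μ = ηL/(1+μη)` is the condition number of the subproblems. -/
def condNumber (γ μ L : ℝ) : ℝ := max 1 ((1 - γ) * L / μ)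

/-- The bracket in the convergence bound, for initial gap `gap = f(π₀) - f(π*)` and `n = |A|`. -/
def rateConst (γ μ gap : ℝ) (n : ℕ) : ℝ :=
  gap + 1 / (1 - γ) * (μ * Real.log n + 5 * (2 - γ) / 2 + 5 / (8 * γ * μ)
    + 5 * μ * γ ^ 2 * (1 + γ) * Real.log n / 4)

/-- `⌈log₂ (B/ε)⌉` epochs (none if `B ≤ ε`). -/
def epochs (B ε : ℝ) : ℕ := ⌈Real.logb 2 (B / ε)⌉₊

/-- The number of evaluations of the gradient `∇h(s,·)` at each state during the first `K` outer
iterations: one for each of the `T k` inner iterations. -/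
def gradEvals (T : ℕ → ℕ) (K : ℕ) : ℕ := ∑ k ∈ Finset.range K, T k

section Method

variable {S A : Type*} [Fintype S] [Fintype A]

/-- The stochastic policy mirror descent method with inexact subproblem solutions, for a given
realization `Qhat` of the estimators. Outer iteration `k` applies, at each state `s`, `T k`
accelerated gradient iterations started at the uniform distribution to
`min_{p ∈ Δ} η [⟨Qhat k s, p⟩ + h(s)(p)] + D_{v k s}^p`,
with `φ = η [⟨Qhat k s, ·⟩ + h(s)]` and `χ = D_{v k s}`; here `x k t s, y k t s` are the inner
iterates and `gradh` is the gradient of `h`. -/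
structure IsInexactSPMD (M : MDP S A) (gradh : S → (A → ℝ) → (A → ℝ)) (μ L : ℝ)
    (T : ℕ → ℕ) (Qhat : ℕ → S → A → ℝ) (π v : ℕ → S → A → ℝ) (x y : ℕ → ℕ → S → A → ℝ) :
    Prop where
  π_zero : π 0 = uniformPolicy S A
  v_zero : v 0 = uniformPolicy S A
  inner : ∀ k s,
    IsAGD (fun p => stepsize M.γ μ • (Qhat k s + gradh s p)) (stepsize M.γ μ * μ)
      (fun p => KL p (v k s))
      (agdWeight (subSmooth M.γ μ L) (subModulus M.γ μ))
      (agdStepsize (subSmooth M.γ μ L) (subModulus M.γ μ))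
      (agdWeight (subSmooth M.γ μ L) (subModulus M.γ μ))
      (uniformPolicy S A s) (T k) (fun t => x k t s) (fun t => y k t s)
  π_succ : ∀ k, π (k + 1) = y k (T k)
  v_succ : ∀ k, v (k + 1) = x k (T k)

/-- The conditions on the estimators `Qhat k` of `Q^{π k}`; `ℱ k` is the information in
`ξ_0, …, ξ_{k-1}`. The conditional bias is at most `ς k` and the conditional expected squared error
at most `σsq k`, in the `ℓ_∞` norm. -/
structure IsEstimator {Ω : Type*} [m : MeasurableSpace Ω] (ℙ : Measure Ω) (ℱ : Filtration ℕ m)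
    (M : MDP S A) (h : S → (A → ℝ) → ℝ) (ς σsq : ℕ → ℝ) (Qhat : ℕ → Ω → S → A → ℝ)
    (π : ℕ → Ω → S → A → ℝ) : Prop where
  measurable : ∀ k s a, StronglyMeasurable[ℱ (k + 1)] (fun ω => Qhat k ω s a)
  bias : ∀ k s a, ∀ᵐ ω ∂ℙ,
    |(ℙ[fun ω' => Qhat k ω' s a | ℱ k]) ω - Q M h (π k ω) s a| ≤ ς k
  integrable : ∀ k, Integrable (fun ω => ‖Qhat k ω - Q M h (π k ω)‖ ^ 2) ℙ
  error : ∀ k, ∀ᵐ ω ∂ℙ,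
    (ℙ[fun ω' => ‖Qhat k ω' - Q M h (π k ω')‖ ^ 2 | ℱ k]) ω ≤ σsq k

end Method

end PMD

end

open PMD

/-!
Read through its first-order conditions, each prox-step is a three-point inequality for the Bregman
distance `KL`, and Pinsker's inequality turns this into the linear convergence of the accelerated
inner iterations. An inexact solution of the subproblem of iteration `k` then bounds the
change of value, and averaging over the stationary distribution of the optimal policy shows that the
potential, the optimality gap plus `μ / (1 - γ)` times the divergence from the prox-iterate,
contracts by the factor `γ`, up to the bias, the variance and the solver error. Since
`γ ^ l ≤ 1 / 4` and these errors are constant on epochs of length `l`, the potential halves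
with every epoch. The policy itself puts at least `√(m / Λ)` times the mass of the prox-iterate on
each action, so its divergence is comparable to that of the prox-iterate, at the price of the
factor `1 + log κ`.
-/

namespace PMD

section Divergence

open InformationTheory (klFun)

theorem hasDerivAt_log_sub_div {u : ℝ} (hu : 0 < u) :
    HasDerivAt (fun u : ℝ => Real.log u - (u - 1) * (5 * u + 1) / (2 * u * (u + 2)))
      ((u - 1) ^ 3 / (u ^ 2 * (u + 2) ^ 2)) u := by
  have hid := hasDerivAt_id' u
  have hnum := (hid.sub_const 1).fun_mul ((hid.const_mul 5).add_const 1)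
  have hden := (hid.const_mul 2).fun_mul (hid.add_const 2)
  refine ((Real.hasDerivAt_log hu.ne').fun_sub
    (hnum.fun_div hden (by positivity))).congr_deriv ?_
  field_simp
  ring

/-- The lower bound on the logarithm that turns into `klFun u ≥ 3 (u - 1)² / (2 (u + 2))`, the
pointwise form of Pinsker's inequality. -/
theorem div_le_log {u : ℝ} (hu : 0 < u) :
    (u - 1) * (5 * u + 1) / (2 * u * (u + 2)) ≤ Real.log u := by
  set G : ℝ → ℝ := fun u => Real.log u - (u - 1) * (5 * u + 1) / (2 * u * (u + 2)) with hG
  have hderiv : ∀ {w : ℝ}, 0 < w → HasDerivAt G ((w - 1) ^ 3 / (w ^ 2 * (w + 2) ^ 2)) w :=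
    hasDerivAt_log_sub_div
  suffices G 1 ≤ G u by simpa [hG] using this
  rcases le_total u 1 with h1 | h1
  · refine antitoneOn_of_hasDerivWithinAt_nonpos (convex_Icc u 1)
      (fun w hw => (hderiv (hu.trans_le hw.1)).continuousAt.continuousWithinAt)
      (fun w hw => (hderiv (hu.trans_le (interior_subset hw).1)).hasDerivWithinAt)
      (fun w hw => div_nonpos_of_nonpos_of_nonneg ?_ (by positivity))
      (Set.left_mem_Icc.2 h1) (Set.right_mem_Icc.2 h1) h1
    exact Odd.pow_nonpos (by decide) (sub_nonpos.2 (interior_subset hw).2)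
  · refine monotoneOn_of_hasDerivWithinAt_nonneg (convex_Icc 1 u)
      (fun w hw => (hderiv (one_pos.trans_le hw.1)).continuousAt.continuousWithinAt)
      (fun w hw => (hderiv (one_pos.trans_le (interior_subset hw).1)).hasDerivWithinAt)
      (fun w hw => div_nonneg ?_ (by positivity))
      (Set.left_mem_Icc.2 h1) (Set.right_mem_Icc.2 h1) h1
    exact pow_nonneg (sub_nonneg.2 (interior_subset hw).1) 3

theorem three_mul_sq_div_le_klFun {u : ℝ} (hu : 0 ≤ u) :
    3 / 2 * (u - 1) ^ 2 / (u + 2) ≤ klFun u := by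
  rcases hu.eq_or_lt with rfl | hu
  · norm_num [InformationTheory.klFun_zero]
  have hlog := mul_le_mul_of_nonneg_left (div_le_log hu) hu.le
  have hsplit : u * ((u - 1) * (5 * u + 1) / (2 * u * (u + 2)))
      = 3 / 2 * (u - 1) ^ 2 / (u + 2) + u - 1 := by
    field_simp
    ring
  rw [InformationTheory.klFun_apply]
  linarith

variable {A : Type*} [Fintype A]

theorem sum_mul_le_of_mem_stdSimplex {w f : A → ℝ} {C : ℝ} (hw : w ∈ stdSimplex ℝ A)
    (hf : ∀ a, f a ≤ C) : ∑ a, w a * f a ≤ C :=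
  calc ∑ a, w a * f a ≤ ∑ a, w a * C :=
        Finset.sum_le_sum fun a _ => mul_le_mul_of_nonneg_left (hf a) (hw.1 a)
    _ = C := by rw [← Finset.sum_mul, hw.2, one_mul]

theorem abs_sum_mul_le_of_mem_stdSimplex {w f : A → ℝ} {C : ℝ} (hw : w ∈ stdSimplex ℝ A)
    (hf : ∀ a, |f a| ≤ C) : |∑ a, w a * f a| ≤ C := by
  refine (Finset.abs_sum_le_sum_abs _ _).trans ?_
  simp only [abs_mul, abs_of_nonneg (hw.1 _)]
  exact sum_mul_le_of_mem_stdSimplex hw hf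

theorem nonempty_of_mem_stdSimplex {w : A → ℝ} (hw : w ∈ stdSimplex ℝ A) : Nonempty A := by
  by_contra hA
  rw [not_nonempty_iff] at hA
  simpa using hw.2

theorem pair_add_left (g g' p : A → ℝ) : pair (g + g') p = pair g p + pair g' p :=
  add_dotProduct g g' p

theorem pair_sub_left (g g' p : A → ℝ) : pair (g - g') p = pair g p - pair g' p :=
  sub_dotProduct g g' p

theorem pair_smul_left (c : ℝ) (g p : A → ℝ) : pair (c • g) p = c * pair g p :=
  smul_dotProduct c g p

theorem pair_add_right (g p p' : A → ℝ) : pair g (p + p') = pair g p + pair g p' :=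
  dotProduct_add g p p'

theorem pair_sub_right (g p p' : A → ℝ) : pair g (p - p') = pair g p - pair g p' :=
  dotProduct_sub g p p'

theorem pair_smul_right (c : ℝ) (g p : A → ℝ) : pair g (c • p) = c * pair g p :=
  dotProduct_smul c g p

theorem pairCLM_apply (g p : A → ℝ) : pairCLM g p = pair g p := by
  simp [pairCLM, pair]

theorem abs_pair_sub_le {g : A → ℝ} {C : ℝ} (hC : ∀ a, |g a| ≤ C) (p p' : A → ℝ) :
    |pair g (p - p')| ≤ C * l1dist p p' := by
  rw [pair, l1dist, Finset.mul_sum]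
  refine (Finset.abs_sum_le_sum_abs _ _).trans (Finset.sum_le_sum fun a _ => ?_)
  rw [abs_mul]
  exact mul_le_mul_of_nonneg_right (hC a) (abs_nonneg _)

theorem l1dist_le_two {p q : A → ℝ} (hp : p ∈ stdSimplex ℝ A) (hq : q ∈ stdSimplex ℝ A) :
    l1dist p q ≤ 2 :=
  calc l1dist p q ≤ ∑ a, (p a + q a) := Finset.sum_le_sum fun a _ => by
        rw [abs_le]
        constructor <;> linarith [hp.1 a, hq.1 a]
    _ = 2 := by rw [Finset.sum_add_distrib, hp.2, hq.2, one_add_one_eq_two]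

theorem l1dist_combination {ρ : ℝ} (hρ : 0 ≤ ρ) (y x x' : A → ℝ) :
    l1dist ((1 - ρ) • y + ρ • x') ((1 - ρ) • y + ρ • x) = ρ * l1dist x' x := by
  rw [l1dist, l1dist, Finset.mul_sum]
  refine Finset.sum_congr rfl fun a _ => ?_
  rw [← abs_of_nonneg hρ, ← abs_mul, abs_of_nonneg hρ]
  congr 1
  simp only [Pi.add_apply, Pi.smul_apply, smul_eq_mul]
  ring

theorem convex_posSimplex : Convex ℝ (posSimplex A) :=
  fun _ hp _ hq _ _ ha hb hab => ⟨convex_stdSimplex ℝ A hp.1 hq.1 ha hb hab,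
    fun a => convex_Ioi (0 : ℝ) (hp.2 a) (hq.2 a) ha hb hab⟩

theorem uniformPolicy_mem {S : Type*} [Nonempty A] (s : S) :
    uniformPolicy S A s ∈ posSimplex A := by
  have hcard : (0 : ℝ) < Fintype.card A := by exact_mod_cast Fintype.card_pos
  have hpos (a : A) : 0 < uniformPolicy S A s a := one_div_pos.2 hcard
  refine ⟨⟨fun a => (hpos a).le, ?_⟩, hpos⟩
  simp only [uniformPolicy, Finset.sum_const, Finset.card_univ, nsmul_eq_mul]
  exact mul_one_div_cancel hcard.ne'

theorem KL_eq_sum_klFun {p q : A → ℝ} (hp : p ∈ stdSimplex ℝ A) (hq : q ∈ posSimplex A) :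
    KL p q = ∑ a, q a * klFun (p a / q a) := by
  have hterm (a : A) : q a * klFun (p a / q a) = p a * Real.log (p a / q a) + q a - p a := by
    have := (hq.2 a).ne'
    rw [InformationTheory.klFun_apply]
    field_simp
  simp only [hterm, Finset.sum_sub_distrib, Finset.sum_add_distrib, hp.2, hq.1.2, KL]
  ring

theorem KL_nonneg {p q : A → ℝ} (hp : p ∈ stdSimplex ℝ A) (hq : q ∈ posSimplex A) :
    0 ≤ KL p q := by
  rw [KL_eq_sum_klFun hp hq]
  exact Finset.sum_nonneg fun a _ => mul_nonneg (hq.2 a).le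
    (InformationTheory.klFun_nonneg (div_nonneg (hp.1 a) (hq.2 a).le))

theorem KL_self {p : A → ℝ} (hp : p ∈ posSimplex A) : KL p p = 0 :=
  Finset.sum_eq_zero fun a _ => by rw [div_self (hp.2 a).ne', Real.log_one, mul_zero]

/-- Pinsker's inequality, by Cauchy-Schwarz with the weights `(p a + 2 * q a) / 3`. -/
theorem sq_l1dist_le {p q : A → ℝ} (hp : p ∈ stdSimplex ℝ A) (hq : q ∈ posSimplex A) :
    l1dist p q ^ 2 ≤ 2 * KL p q := by
  have hweight_pos (a : A) : 0 < (p a + 2 * q a) / 3 := by linarith [hp.1 a, hq.2 a]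
  have hweight_sum : ∑ a, (p a + 2 * q a) / 3 = 1 := by
    rw [← Finset.sum_div, Finset.sum_add_distrib, ← Finset.mul_sum, hp.2, hq.1.2]
    norm_num
  have hterm (a : A) : |p a - q a| ^ 2 / ((p a + 2 * q a) / 3)
      = 2 * (q a * (3 / 2 * (p a / q a - 1) ^ 2 / (p a / q a + 2))) := by
    have := hq.2 a
    have : p a + 2 * q a ≠ 0 := by linarith [hweight_pos a]
    have hden : p a / q a + 2 = (p a + 2 * q a) / q a := by field_simp
    rw [sq_abs, hden]
    field_simp
  have hcauchy := Finset.sq_sum_div_le_sum_sq_div Finset.univ (fun a => |p a - q a|)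
    (fun a _ => hweight_pos a)
  rw [hweight_sum, div_one] at hcauchy
  refine hcauchy.trans ?_
  rw [KL_eq_sum_klFun hp hq, Finset.mul_sum]
  refine Finset.sum_le_sum fun a _ => ?_
  rw [hterm]
  have hq0 := hq.2 a
  gcongr
  exact three_mul_sq_div_le_klFun (div_nonneg (hp.1 a) hq0.le)

/-- The negative entropy, the distance generating function whose Bregman distance is `KL`. -/
noncomputable def negEntropy (p : A → ℝ) : ℝ := ∑ a, p a * Real.log (p a)

theorem convexOn_negEntropy : ConvexOn ℝ {p : A → ℝ | ∀ a, 0 ≤ p a} negEntropy := by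
  refine ⟨convex_Ici (0 : A → ℝ), fun p hp q hq a b ha hb hab => ?_⟩
  simp only [negEntropy, smul_eq_mul, Finset.mul_sum, ← Finset.sum_add_distrib]
  exact Finset.sum_le_sum fun i _ => Real.convexOn_mul_log.2 (hp i) (hq i) ha hb hab

theorem hasFDerivAt_negEntropy {p : A → ℝ} (hp : ∀ a, 0 < p a) :
    HasFDerivAt negEntropy (pairCLM fun a => Real.log (p a) + 1) p := by
  refine HasFDerivAt.fun_sum fun a _ => ?_
  exact HasDerivAt.comp_hasFDerivAt (f := fun p : A → ℝ => p a) p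
    (Real.hasDerivAt_mul_log (hp a).ne') (hasFDerivAt_apply a p)

theorem KL_eq_negEntropy_sub (p : A → ℝ) {q : A → ℝ} (hq : ∀ a, 0 < q a) :
    KL p q = negEntropy p - pair (fun a => Real.log (q a)) p := by
  rw [KL, negEntropy, pair, ← Finset.sum_sub_distrib]
  refine Finset.sum_congr rfl fun a _ => ?_
  by_cases h0 : p a = 0
  · simp [h0]
  · rw [Real.log_div h0 (hq a).ne']
    ring

theorem KL_convex_left {p p' q : A → ℝ} (hp : ∀ a, 0 ≤ p a) (hp' : ∀ a, 0 ≤ p' a)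
    (hq : ∀ a, 0 < q a) {a b : ℝ} (ha : 0 ≤ a) (hb : 0 ≤ b) (hab : a + b = 1) :
    KL (a • p + b • p') q ≤ a * KL p q + b * KL p' q := by
  have hconv := convexOn_negEntropy.2 hp hp' ha hb hab
  simp only [KL_eq_negEntropy_sub _ hq, pair_add_right, pair_smul_right, smul_eq_mul] at hconv ⊢
  linarith

theorem KL_uniformPolicy_le {S : Type*} [Nonempty A] (s : S) {p : A → ℝ}
    (hp : p ∈ stdSimplex ℝ A) : KL p (uniformPolicy S A s) ≤ Real.log (Fintype.card A) := by
  refine sum_mul_le_of_mem_stdSimplex hp fun a => ?_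
  have hcard : (0 : ℝ) < Fintype.card A := by exact_mod_cast Fintype.card_pos
  rw [uniformPolicy, div_div_eq_mul_div, div_one]
  rcases (hp.1 a).eq_or_lt with h0 | h0
  · rw [← h0, zero_mul, Real.log_zero]
    exact Real.log_natCast_nonneg _
  · exact Real.log_le_log (by positivity)
      (mul_le_of_le_one_left hcard.le (mem_Icc_of_mem_stdSimplex hp a).2)

end Divergence

section ProximalStep

variable {A : Type*} [Fintype A]

/-- The three-point inequality: minimality enters only through the first-order condition at `x`,
and the Bregman distance of the negative entropy measures the second-order gap. -/
theorem add_mul_KL_le_of_isMinOn {w x : A → ℝ} {c : ℝ} (hx : x ∈ posSimplex A)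
    (hmin : IsMinOn (fun p => pair w p + c * negEntropy p) (stdSimplex ℝ A) x)
    {p : A → ℝ} (hp : p ∈ stdSimplex ℝ A) :
    pair w x + c * negEntropy x + c * KL p x ≤ pair w p + c * negEntropy p := by
  have hderiv : HasFDerivAt (fun p => pair w p + c * negEntropy p)
      (pairCLM w + c • pairCLM fun a => Real.log (x a) + 1) x := by
    have hlin : HasFDerivAt (pair w) (pairCLM w) x :=
      funext (pairCLM_apply w) ▸ (pairCLM w).hasFDerivAt
    exact hlin.add ((hasFDerivAt_negEntropy hx.2).const_mul c)
  have hfirst := hmin.localize.hasFDerivWithinAt_nonneg hderiv.hasFDerivWithinAt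
    (sub_mem_posTangentConeAt_of_segment_subset ((convex_stdSimplex ℝ A).segment_subset hx.1 hp))
  have hone {q : A → ℝ} (hq : q ∈ stdSimplex ℝ A) : pair (fun _ => 1) q = 1 := by
    simpa only [pair, one_mul] using hq.2
  have hlog : pair (fun a => Real.log (x a)) x = negEntropy x :=
    Finset.sum_congr rfl fun a _ => mul_comm _ _
  have hsplit : (fun a => Real.log (x a) + 1) = (fun a => Real.log (x a)) + fun _ => 1 := rfl
  simp only [add_apply, smul_apply, smul_eq_mul, pairCLM_apply, hsplit, pair_add_left,
    pair_sub_right, hone hp, hone hx.1, hlog] at hfirst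
  rw [KL_eq_negEntropy_sub p hx.2]
  linarith

theorem proxObjective_eq {g z v x₀ : A → ℝ} (r μφ : ℝ) (hz : ∀ a, 0 < z a)
    (hv : ∀ a, 0 < v a) (hx₀ : ∀ a, 0 < x₀ a) (p : A → ℝ) :
    r * (pair g p + μφ * KL p z + KL p v) + KL p x₀
      = pair (r • (g - μφ • (fun a => Real.log (z a)) - fun a => Real.log (v a))
          - fun a => Real.log (x₀ a)) p + (1 + r * (1 + μφ)) * negEntropy p := by
  simp only [KL_eq_negEntropy_sub p hz, KL_eq_negEntropy_sub p hv, KL_eq_negEntropy_sub p hx₀,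
    pair_sub_left, pair_smul_left]
  ring

theorem prox_add_mul_KL_le {g z v x₀ x : A → ℝ} {r μφ : ℝ} (hz : ∀ a, 0 < z a)
    (hv : ∀ a, 0 < v a) (hx₀ : ∀ a, 0 < x₀ a) (hx : x ∈ posSimplex A)
    (hmin : IsMinOn (fun p => r * (pair g p + μφ * KL p z + KL p v) + KL p x₀)
      (stdSimplex ℝ A) x)
    {p : A → ℝ} (hp : p ∈ stdSimplex ℝ A) :
    r * (pair g x + μφ * KL x z + KL x v) + KL x x₀ + (1 + r * (1 + μφ)) * KL p x
      ≤ r * (pair g p + μφ * KL p z + KL p v) + KL p x₀ := by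
  simp only [proxObjective_eq r μφ hz hv hx₀] at hmin ⊢
  exact add_mul_KL_le_of_isMinOn hx hmin hp

end ProximalStep

section AcceleratedGradient

variable {A : Type*} [Fintype A]

theorem agd_step {φ : (A → ℝ) → ℝ} {g v x y x' y' z : A → ℝ} {μφ Lφ r ρ : ℝ}
    (hμφ : 0 ≤ μφ) (hLφ : 0 ≤ Lφ) (hr : 0 < r) (hρ : 0 ≤ ρ) (hρ1 : ρ ≤ 1)
    (hLρ : 2 * Lφ * ρ ^ 2 ≤ ρ / r)
    (hv : v ∈ posSimplex A) (hx : x ∈ posSimplex A) (hy : y ∈ posSimplex A)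
    (hx' : x' ∈ posSimplex A)
    (hz : z = (1 - ρ) • y + ρ • x) (hy' : y' = (1 - ρ) • y + ρ • x')
    (hstrong : ∀ p ∈ stdSimplex ℝ A, φ z + pair g (p - z) + μφ * KL p z ≤ φ p)
    (hsmooth : φ y' ≤ φ z + pair g (y' - z) + Lφ * l1dist y' z ^ 2)
    (hmin : IsMinOn (fun p => r * (pair g p + μφ * KL p z + KL p v) + KL p x)
      (stdSimplex ℝ A) x')
    {p : A → ℝ} (hp : p ∈ stdSimplex ℝ A) :
    φ y' + KL y' v - (φ p + KL p v) + (ρ / r + ρ * (1 + μφ)) * KL p x'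
      ≤ (1 - ρ) * (φ y + KL y v - (φ p + KL p v)) + ρ / r * KL p x := by
  have hρ1' : 0 ≤ 1 - ρ := sub_nonneg.2 hρ1
  have hzpos : z ∈ posSimplex A := hz ▸ convex_posSimplex hy hx hρ1' hρ (by ring)
  have hprox : ρ * (pair g x' + μφ * KL x' z + KL x' v) + ρ / r * KL x' x
        + (ρ / r + ρ * (1 + μφ)) * KL p x'
      ≤ ρ * (pair g p + μφ * KL p z + KL p v) + ρ / r * KL p x := by
    have := mul_le_mul_of_nonneg_left
      (prox_add_mul_KL_le hzpos.2 hv.2 hx.2 hx' hmin hp) (div_nonneg hρ hr.le)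
    field_simp at this ⊢
    linarith
  have hquadratic : Lφ * l1dist y' z ^ 2 ≤ ρ / r * KL x' x := by
    calc Lφ * l1dist y' z ^ 2 = Lφ * ρ ^ 2 * l1dist x' x ^ 2 := by
          rw [hy', hz, l1dist_combination hρ]; ring
      _ ≤ Lφ * ρ ^ 2 * (2 * KL x' x) := by gcongr; exact sq_l1dist_le hx'.1 hx
      _ = 2 * Lφ * ρ ^ 2 * KL x' x := by ring
      _ ≤ ρ / r * KL x' x := mul_le_mul_of_nonneg_right hLρ (KL_nonneg hx'.1 hx)
  have hχ : KL y' v ≤ (1 - ρ) * KL y v + ρ * KL x' v :=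
    hy' ▸ KL_convex_left hy.1.1 hx'.1.1 hv.2 hρ1' hρ (by ring)
  have hlin : pair g y' = (1 - ρ) * pair g y + ρ * pair g x' := by
    rw [hy', pair_add_right, pair_smul_right, pair_smul_right]
  have hφy := mul_le_mul_of_nonneg_left (hstrong y hy.1) hρ1'
  have hφp := mul_le_mul_of_nonneg_left (hstrong p hp) hρ
  have hKLx := mul_nonneg hρ (mul_nonneg hμφ (KL_nonneg hx'.1 hzpos))
  have hKLy := mul_nonneg hρ1' (mul_nonneg hμφ (KL_nonneg hy.1 hzpos))
  simp only [pair_sub_right, hlin] at hsmooth hφy hφp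
  linarith

variable {Λ m : ℝ}

theorem sqrt_div_pos (hm : 0 < m) (hΛ : 4 * m ≤ Λ) : 0 < √(m / Λ) :=
  Real.sqrt_pos.2 (div_pos hm (by linarith))

theorem sqrt_div_le_half (hm : 0 < m) (hΛ : 4 * m ≤ Λ) : √(m / Λ) ≤ 1 / 2 := by
  rw [Real.sqrt_le_left (by norm_num), div_le_iff₀ (by linarith)]
  linarith

theorem le_agdSwitch_iff (hm : 0 < m) (hΛ : 4 * m ≤ Λ) (t : ℕ) :
    t ≤ agdSwitch Λ m ↔ ((t : ℝ) + 1) * √(m / Λ) ≤ 2 := by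
  have hα := sqrt_div_pos hm hΛ
  have hinv : √(Λ / m) = (√(m / Λ))⁻¹ := by rw [← Real.sqrt_inv, inv_div]
  have htwo : 2 ≤ (√(m / Λ))⁻¹ := by
    rw [le_inv_comm₀ two_pos hα, ← one_div]
    exact sqrt_div_le_half hm hΛ
  rw [agdSwitch, Nat.le_floor_iff (by rw [hinv]; linarith), hinv, ← div_eq_mul_inv,
    ← le_div_iff₀ hα, le_sub_iff_add_le]

theorem sqrt_div_le_agdWeight (hm : 0 < m) (hΛ : 4 * m ≤ Λ) (t : ℕ) :
    √(m / Λ) ≤ agdWeight Λ m t := by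
  rw [agdWeight]
  split_ifs with hs
  · rw [le_div_iff₀ (by positivity), mul_comm]
    exact (le_agdSwitch_iff hm hΛ t).1 hs
  · exact le_rfl

theorem agdWeight_le_one (hm : 0 < m) (hΛ : 4 * m ≤ Λ) {t : ℕ} (ht : 1 ≤ t) :
    agdWeight Λ m t ≤ 1 := by
  have ht' : (1 : ℝ) ≤ t := by exact_mod_cast ht
  rw [agdWeight]
  split_ifs
  · rw [div_le_one (by positivity)]
    linarith
  · linarith [sqrt_div_le_half hm hΛ]

theorem agdStepsize_pos (hm : 0 < m) (hΛ : 4 * m ≤ Λ) {t : ℕ} (ht : 1 ≤ t) :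
    0 < agdStepsize Λ m t := by
  have hΛ0 : 0 < Λ := by linarith
  have : (0 : ℝ) < t := by exact_mod_cast ht
  rw [agdStepsize]
  split_ifs
  · positivity
  · refine one_div_pos.2 (sub_pos.2 (Real.lt_sqrt_of_sq_lt ?_))
    nlinarith

theorem agdWeight_div_agdStepsize_of_le {t : ℕ} (ht : t ≤ agdSwitch Λ m) :
    agdWeight Λ m t / agdStepsize Λ m t = 4 * Λ / (t * (t + 1)) := by
  rw [agdWeight, agdStepsize, if_pos ht, if_pos ht, div_div_div_eq]
  ring

theorem agdWeight_div_agdStepsize_of_gt (hm : 0 < m) (hΛ : 4 * m ≤ Λ) {t : ℕ}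
    (ht : ¬ t ≤ agdSwitch Λ m) :
    agdWeight Λ m t / agdStepsize Λ m t = m * (1 - √(m / Λ)) := by
  have hΛ0 : 0 < Λ := by linarith
  have hprod : √(m / Λ) * √(Λ * m) = m := by
    rw [← Real.sqrt_mul (by positivity), show m / Λ * (Λ * m) = m ^ 2 by field_simp,
      Real.sqrt_sq hm.le]
  rw [agdWeight, agdStepsize, if_neg ht, if_neg ht, div_div_eq_mul_div, div_one, mul_sub, hprod]
  ring

theorem mul_sq_agdWeight_le (hm : 0 < m) (hΛ : 4 * m ≤ Λ) {t : ℕ} (ht : 1 ≤ t) :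
    Λ * agdWeight Λ m t ^ 2 ≤ 2 * (agdWeight Λ m t / agdStepsize Λ m t) := by
  have hΛ0 : 0 < Λ := by linarith
  by_cases hs : t ≤ agdSwitch Λ m
  · have : (1 : ℝ) ≤ t := by exact_mod_cast ht
    rw [agdWeight_div_agdStepsize_of_le hs, agdWeight, if_pos hs, div_pow, mul_div_assoc',
      mul_div_assoc', div_le_div_iff₀ (by positivity) (by positivity)]
    have : 0 ≤ Λ * ((t : ℝ) + 1) := by positivity
    nlinarith
  · rw [agdWeight_div_agdStepsize_of_gt hm hΛ hs, agdWeight, if_neg hs,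
      Real.sq_sqrt (by positivity), mul_div_cancel₀ m hΛ0.ne']
    nlinarith [sqrt_div_le_half hm hΛ]

theorem two_div_le_pow (hm : 0 < m) (hΛ : 4 * m ≤ Λ) {t : ℕ} (ht : 1 ≤ t)
    (hts : t ≤ agdSwitch Λ m) :
    2 / ((t : ℝ) * ((t : ℝ) + 1)) ≤ (1 - √(m / Λ)) ^ (t - 1) := by
  induction t, ht using Nat.le_induction with
  | base => norm_num
  | succ t ht ih =>
    have hα2 := sqrt_div_le_half hm hΛ
    have : (1 : ℝ) ≤ t := by exact_mod_cast ht
    have hratio : (t : ℝ) / (t + 2) ≤ 1 - √(m / Λ) := by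
      have := (le_agdSwitch_iff hm hΛ (t + 1)).1 hts
      push_cast at this
      rw [div_le_iff₀ (by positivity)]
      linarith
    calc 2 / (((t + 1 : ℕ) : ℝ) * (((t + 1 : ℕ) : ℝ) + 1))
        = 2 / ((t : ℝ) * ((t : ℝ) + 1)) * (t / (t + 2)) := by push_cast; field_simp; ring
      _ ≤ (1 - √(m / Λ)) ^ (t - 1) * (1 - √(m / Λ)) :=
          mul_le_mul (ih (by lia)) hratio (by positivity) (pow_nonneg (by linarith) _)
      _ = (1 - √(m / Λ)) ^ (t + 1 - 1) := by rw [← pow_succ]; congr 1; lia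

theorem agdAccuracy_of_le_switch (hm : 0 < m) (hΛ : 4 * m ≤ Λ) {t : ℕ} (ht : 1 ≤ t)
    (hts : t ≤ agdSwitch Λ m) :
    agdAccuracy Λ m t = 4 * Λ / ((t : ℝ) * ((t : ℝ) + 1)) := by
  rw [agdAccuracy, min_eq_right (two_div_le_pow hm hΛ ht hts)]
  ring

theorem mul_agdAccuracy_le_succ (hm : 0 < m) (hΛ : 4 * m ≤ Λ) {t : ℕ} (ht : 1 ≤ t)
    (hts : ¬ t + 1 ≤ agdSwitch Λ m) :
    (1 - √(m / Λ)) * agdAccuracy Λ m t ≤ agdAccuracy Λ m (t + 1) := by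
  have hΛ0 : 0 < Λ := by linarith
  have h1α : 0 ≤ 1 - √(m / Λ) := by linarith [sqrt_div_le_half hm hΛ]
  have ht' : (1 : ℝ) ≤ t := by exact_mod_cast ht
  rw [agdAccuracy, agdAccuracy, mul_left_comm, mul_min_of_nonneg _ _ h1α]
  refine mul_le_mul_of_nonneg_left (min_le_min ?_ ?_) (by positivity)
  · rw [← pow_succ', Nat.sub_add_cancel ht, Nat.add_sub_cancel]
  · have hratio : 1 - √(m / Λ) ≤ (t : ℝ) / (t + 2) := by
      rw [le_agdSwitch_iff hm hΛ] at hts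
      push_cast at hts
      rw [le_div_iff₀ (by positivity)]
      linarith
    calc (1 - √(m / Λ)) * (2 / ((t : ℝ) * ((t : ℝ) + 1)))
        ≤ t / (t + 2) * (2 / ((t : ℝ) * ((t : ℝ) + 1))) := by gcongr
      _ = 2 / (((t + 1 : ℕ) : ℝ) * (((t + 1 : ℕ) : ℝ) + 1)) := by push_cast; field_simp; ring

variable {T : ℕ} {δ D : ℕ → ℝ}

theorem agd_recursion_of_le_switch (hm : 0 ≤ m) (hD : ∀ t ≤ T, 0 ≤ D t)
    (hstep : ∀ t < T, δ (t + 1) + (agdWeight Λ m (t + 1) / agdStepsize Λ m (t + 1)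
        + agdWeight Λ m (t + 1) * m) * D (t + 1)
      ≤ (1 - agdWeight Λ m (t + 1)) * δ t
        + agdWeight Λ m (t + 1) / agdStepsize Λ m (t + 1) * D t)
    {t : ℕ} (htT : t ≤ T) (hts : t ≤ agdSwitch Λ m) :
    (t : ℝ) * (t + 1) * δ t + (4 * Λ + 2 * t * m) * D t ≤ 4 * Λ * D 0 := by
  induction t with
  | zero => simp
  | succ t ih =>
    have hprev := ih (by lia) (by lia)
    have hnext := hstep t (by lia)
    rw [agdWeight_div_agdStepsize_of_le hts, agdWeight, if_pos hts] at hnext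
    push_cast at hnext ⊢
    have hscaled : ((t : ℝ) + 1) * (t + 1 + 1) * δ (t + 1) + (4 * Λ + 2 * (t + 1) * m) * D (t + 1)
        ≤ (t : ℝ) * (t + 1) * δ t + 4 * Λ * D t := by
      field_simp at hnext
      linarith
    have hDt : 0 ≤ 2 * (t : ℝ) * m * D t := mul_nonneg (by positivity) (hD t (by lia))
    linarith

theorem agd_recursion (hm : 0 < m) (hΛ : 4 * m ≤ Λ) (hD : ∀ t ≤ T, 0 ≤ D t)
    (hstep : ∀ t < T, δ (t + 1) + (agdWeight Λ m (t + 1) / agdStepsize Λ m (t + 1)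
        + agdWeight Λ m (t + 1) * m) * D (t + 1)
      ≤ (1 - agdWeight Λ m (t + 1)) * δ t
        + agdWeight Λ m (t + 1) / agdStepsize Λ m (t + 1) * D t)
    {t : ℕ} (ht : 1 ≤ t) (htT : t ≤ T) : δ t + m * D t ≤ agdAccuracy Λ m t * D 0 := by
  have hΛ0 : 0 < Λ := by linarith
  have hα2 := sqrt_div_le_half hm hΛ
  have hpolynomial : ∀ {t : ℕ}, 1 ≤ t → t ≤ T → t ≤ agdSwitch Λ m →
      δ t + m * D t ≤ agdAccuracy Λ m t * D 0 := fun {t} ht htT hts => by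
    have : (1 : ℝ) ≤ t := by exact_mod_cast ht
    have hmodulus : (t : ℝ) * (t + 1) * m ≤ 4 * Λ + 2 * t * m := by
      have hsq := pow_le_pow_left₀ (by positivity) ((le_agdSwitch_iff hm hΛ t).1 hts) 2
      rw [mul_pow, Real.sq_sqrt (by positivity), mul_div_assoc', div_le_iff₀ hΛ0] at hsq
      nlinarith
    have := agd_recursion_of_le_switch hm.le hD hstep htT hts
    have := mul_le_mul_of_nonneg_right hmodulus (hD t htT)
    rw [agdAccuracy_of_le_switch hm hΛ ht hts, div_mul_eq_mul_div, le_div_iff₀ (by positivity)]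
    linarith
  induction t, ht using Nat.le_induction with
  | base =>
    refine hpolynomial le_rfl htT ((le_agdSwitch_iff hm hΛ 1).2 ?_)
    push_cast
    linarith
  | succ t ht ih =>
    by_cases hs : t + 1 ≤ agdSwitch Λ m
    · exact hpolynomial (by lia) htT hs
    have hcontract := hstep t (by lia)
    rw [agdWeight_div_agdStepsize_of_gt hm hΛ hs, agdWeight, if_neg hs] at hcontract
    calc δ (t + 1) + m * D (t + 1) ≤ (1 - √(m / Λ)) * (δ t + m * D t) := by linarith
      _ ≤ (1 - √(m / Λ)) * (agdAccuracy Λ m t * D 0) :=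
          mul_le_mul_of_nonneg_left (ih (by lia)) (by linarith)
      _ ≤ agdAccuracy Λ m (t + 1) * D 0 := by
          rw [← mul_assoc]
          exact mul_le_mul_of_nonneg_right (mul_agdAccuracy_le_succ hm hΛ ht hs) (hD 0 (by lia))

variable {φ : (A → ℝ) → ℝ} {gφ : (A → ℝ) → (A → ℝ)} {χ : (A → ℝ) → ℝ} {μφ Lφ : ℝ}
  {start v p : A → ℝ} {r : ℕ → ℝ} {x y : ℕ → A → ℝ} {R : Set (A → ℝ)}

theorem le_add_sq_of_lipschitz {p q : A → ℝ} (hμφ : 0 ≤ μφ) (hp : p ∈ posSimplex A)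
    (hq : q ∈ stdSimplex ℝ A) (hstrong : φ p + pair (gφ p) (q - p) + μφ * KL q p ≤ φ q)
    (hlip : ∀ a, |gφ p a - gφ q a| ≤ Lφ * l1dist p q) :
    φ p ≤ φ q + pair (gφ q) (p - q) + Lφ * l1dist p q ^ 2 := by
  have hgrad := (le_abs_self _).trans (abs_pair_sub_le (g := gφ p - gφ q) hlip p q)
  have hKL := mul_nonneg hμφ (KL_nonneg hq hp)
  simp only [pair_sub_left, pair_sub_right] at hgrad hstrong ⊢
  linarith

theorem IsAGD.y_mem (hm : 0 < m) (hΛ : 4 * m ≤ Λ)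
    (h : IsAGD gφ μφ χ (agdWeight Λ m) r (agdWeight Λ m) start T x y)
    (hstart : start ∈ stdSimplex ℝ A) {t : ℕ} (ht : t ≤ T) : y t ∈ stdSimplex ℝ A := by
  induction t with
  | zero => exact h.y_zero ▸ hstart
  | succ t ih =>
    have hw := (sqrt_div_pos hm hΛ).trans_le (sqrt_div_le_agdWeight hm hΛ (t + 1))
    have hw1 := agdWeight_le_one hm hΛ (Nat.le_add_left 1 t)
    rw [h.y_step t ht]
    exact convex_stdSimplex ℝ A (ih (by lia)) (h.x_mem t ht) (by linarith) hw.le (by ring)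

theorem IsAGD.mul_x_le_y (hm : 0 < m) (hΛ : 4 * m ≤ Λ)
    (h : IsAGD gφ μφ χ (agdWeight Λ m) r (agdWeight Λ m) start T x y)
    (hstart : start ∈ stdSimplex ℝ A) (hT : 1 ≤ T) (a : A) :
    √(m / Λ) * x T a ≤ y T a := by
  obtain ⟨t, rfl⟩ := Nat.exists_eq_add_of_le' hT
  have hy := (h.y_mem hm hΛ hstart (Nat.le_succ t)).1 a
  have hx := (h.x_mem t t.lt_succ_self).1 a
  rw [h.y_step t t.lt_succ_self]
  exact le_add_of_nonneg_of_le (mul_nonneg (sub_nonneg.2 (agdWeight_le_one hm hΛ hT)) hy)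
    (mul_le_mul_of_nonneg_right (sqrt_div_le_agdWeight hm hΛ _) hx)

theorem IsAGD.accuracy (hμφ : 0 ≤ μφ) (hΛ : 4 * (1 + μφ) ≤ Λ) (hLφ : 0 ≤ Lφ) (hLΛ : 4 * Lφ ≤ Λ)
    (h : IsAGD gφ μφ (fun p => KL p v) (agdWeight Λ (1 + μφ)) (agdStepsize Λ (1 + μφ))
      (agdWeight Λ (1 + μφ)) start T x y)
    (hv : v ∈ posSimplex A) (hRpos : R ⊆ posSimplex A) (hRconv : Convex ℝ R)
    (hR : ∀ t ≤ T, x t ∈ R ∧ y t ∈ R)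
    (hstrong : ∀ p ∈ stdSimplex ℝ A, ∀ p' ∈ posSimplex A,
      φ p' + pair (gφ p') (p - p') + μφ * KL p p' ≤ φ p)
    (hlip : ∀ p ∈ R, ∀ p' ∈ R, ∀ a, |gφ p a - gφ p' a| ≤ Lφ * l1dist p p')
    (hp : p ∈ stdSimplex ℝ A) (hT : 1 ≤ T) :
    φ (y T) + KL (y T) v - (φ p + KL p v) + (1 + μφ) * KL p (x T)
      ≤ agdAccuracy Λ (1 + μφ) T * KL p start := by
  have hm : 0 < 1 + μφ := by linarith
  rw [← h.x_zero]
  refine agd_recursion (δ := fun t => φ (y t) + KL (y t) v - (φ p + KL p v))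
    (D := fun t => KL p (x t)) hm hΛ (fun t ht => KL_nonneg hp (hRpos (hR t ht).1))
    (fun t ht => ?_) hT le_rfl
  set w := agdWeight Λ (1 + μφ) (t + 1)
  have hw : 0 < w := (sqrt_div_pos hm hΛ).trans_le (sqrt_div_le_agdWeight hm hΛ (t + 1))
  have hw1 : w ≤ 1 := agdWeight_le_one hm hΛ (Nat.le_add_left 1 t)
  obtain ⟨hx, hy⟩ := hR t ht.le
  obtain ⟨hx', hy'⟩ := hR (t + 1) ht
  have hz : (1 - w) • y t + w • x t ∈ R := hRconv hy hx (sub_nonneg.2 hw1) hw.le (by ring)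
  have hLw : 2 * Lφ * w ^ 2 ≤ w / agdStepsize Λ (1 + μφ) (t + 1) := by
    linarith [mul_sq_agdWeight_le hm hΛ (Nat.le_add_left 1 t),
      mul_le_mul_of_nonneg_right hLΛ (sq_nonneg w)]
  exact agd_step hμφ hLφ (agdStepsize_pos hm hΛ (Nat.le_add_left 1 t)) hw.le hw1 hLw hv
    (hRpos hx) (hRpos hy) (hRpos hx') rfl (h.y_step t ht)
    (fun q hq => hstrong q hq _ (hRpos hz))
    (le_add_sq_of_lipschitz hμφ (hRpos hy') (hRpos hz).1
      (hstrong _ (hRpos hz).1 _ (hRpos hy')) (hlip _ hy' _ hz))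
    (h.x_step t ht _ rfl) hp

end AcceleratedGradient

section Comparison

open InformationTheory (klFun)

theorem mul_le_klFun_add_exp {u : ℝ} (hu : 0 ≤ u) (t : ℝ) :
    u * t ≤ klFun u + Real.exp t - 1 := by
  rw [InformationTheory.klFun_apply]
  rcases hu.eq_or_lt with rfl | hu
  · simpa using Real.exp_nonneg t
  have hexp := mul_le_mul_of_nonneg_left (Real.add_one_le_exp (t - Real.log u)) hu.le
  rw [Real.exp_sub, Real.exp_log hu, mul_div_cancel₀ _ hu.ne'] at hexp
  linarith

/-- Where `y` is bounded below, the cross term `-u log y` is absorbed by Young's inequality; where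
`y` is small, `klFun y` is bounded below and pays for the crude bound `-log y ≤ -log ρ`. -/
theorem mul_log_div_le_klFun {u y ρ : ℝ} (hu : 0 ≤ u) (hρ : 0 < ρ) (hρ1 : ρ ≤ 1) (hy : ρ ≤ y) :
    u * Real.log (u / y) - u + y
      ≤ (2 - Real.log ρ) * klFun u + (4 - 12 * Real.log ρ) * klFun y := by
  have hy0 : 0 < y := hρ.trans_le hy
  have hlogρ : Real.log ρ ≤ 0 := Real.log_nonpos hρ.le hρ1
  have hu_kl := InformationTheory.klFun_nonneg hu
  have hy_kl := InformationTheory.klFun_nonneg hy0.le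
  have hquad := three_mul_sq_div_le_klFun hy0.le
  have hsplit : u * Real.log (u / y) - u + y = klFun u + (y - 1) - u * Real.log y := by
    rw [InformationTheory.klFun_apply]
    rcases hu.eq_or_lt with rfl | hu
    · simp
    · rw [Real.log_div hu.ne' hy0.ne']
      ring
  rw [hsplit]
  rcases le_or_gt (1 / 2) y with hy2 | hy2
  · have hyoung := mul_le_klFun_add_exp hu (-Real.log y)
    rw [Real.exp_neg, Real.exp_log hy0] at hyoung
    have hsq : y - 1 + (y⁻¹ - 1) ≤ 4 * (3 / 2 * (y - 1) ^ 2 / (y + 2)) := by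
      rw [show y - 1 + (y⁻¹ - 1) = (y - 1) ^ 2 / y by field_simp; ring, mul_div_assoc',
        div_le_div_iff₀ hy0 (by linarith)]
      nlinarith [mul_nonneg (sq_nonneg (y - 1)) (sub_nonneg.2 hy2)]
    nlinarith [mul_nonneg (neg_nonneg.2 hlogρ) hu_kl, mul_nonneg (neg_nonneg.2 hlogρ) hy_kl]
  · have hlog : -(u * Real.log y) ≤ -Real.log ρ * u := by
      nlinarith [mul_le_mul_of_nonneg_left (Real.log_le_log hρ hy) hu]
    have hyoung := mul_le_klFun_add_exp hu 1
    have hsq : 3 / 20 ≤ klFun y := by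
      refine le_trans ?_ hquad
      rw [le_div_iff₀ (by linarith)]
      nlinarith
    nlinarith [mul_le_mul_of_nonneg_left hyoung (neg_nonneg.2 hlogρ),
      mul_le_mul_of_nonneg_left hsq (neg_nonneg.2 hlogρ),
      mul_le_mul_of_nonneg_left Real.exp_one_lt_d9.le (neg_nonneg.2 hlogρ)]

variable {A : Type*} [Fintype A]

theorem KL_le_of_mul_le {p x y : A → ℝ} {ρ : ℝ} (hp : p ∈ stdSimplex ℝ A) (hx : x ∈ posSimplex A)
    (hy : y ∈ posSimplex A) (hρ : 0 < ρ) (hρ1 : ρ ≤ 1) (hxy : ∀ a, ρ * x a ≤ y a) :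
    KL p y ≤ (2 - Real.log ρ) * KL p x + (4 - 12 * Real.log ρ) * KL y x := by
  have hsum : KL p y = ∑ a, (p a * Real.log (p a / y a) - p a + y a) := by
    rw [Finset.sum_add_distrib, Finset.sum_sub_distrib, hp.2, hy.1.2, KL]
    ring
  rw [hsum, KL_eq_sum_klFun hp hx, KL_eq_sum_klFun hy.1 hx, Finset.mul_sum, Finset.mul_sum,
    ← Finset.sum_add_distrib]
  refine Finset.sum_le_sum fun a _ => ?_
  have hxa := hx.2 a
  have hratio := mul_le_mul_of_nonneg_left (mul_log_div_le_klFun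
    (div_nonneg (hp.1 a) hxa.le) hρ hρ1 ((le_div_iff₀ hxa).2 (hxy a))) hxa.le
  calc p a * Real.log (p a / y a) - p a + y a
      = x a * (p a / x a * Real.log (p a / x a / (y a / x a)) - p a / x a + y a / x a) := by
        rw [div_div_div_cancel_right₀ hxa.ne']
        field_simp
    _ ≤ _ := hratio
    _ = _ := by ring

end Comparison

section Value

variable {S A : Type*} [Fintype S] [Fintype A] {M : MDP S A} {h : S → (A → ℝ) → ℝ}
  {π π' : S → A → ℝ}

theorem stepOp_le (hπ : IsPolicy π) {g : S → ℝ} {C : ℝ} (hg : ∀ s, g s ≤ C) (s : S) :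
    stepOp M π g s ≤ C :=
  sum_mul_le_of_mem_stdSimplex (hπ s) fun a => sum_mul_le_of_mem_stdSimplex (M.P_mem s a) hg

theorem abs_stepOp_le (hπ : IsPolicy π) {g : S → ℝ} {C : ℝ} (hg : ∀ s, |g s| ≤ C) (s : S) :
    |stepOp M π g s| ≤ C :=
  abs_sum_mul_le_of_mem_stdSimplex (hπ s) fun a => abs_sum_mul_le_of_mem_stdSimplex (M.P_mem s a) hg

theorem stepOp_sub (g g' : S → ℝ) (s : S) :
    stepOp M π (fun s => g s - g' s) s = stepOp M π g s - stepOp M π g' s := by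
  simp only [stepOp, mul_sub, Finset.sum_sub_distrib]

theorem abs_iterate_stepOp_le (hπ : IsPolicy π) {g : S → ℝ} {C : ℝ} (hg : ∀ s, |g s| ≤ C)
    (t : ℕ) (s : S) : |(stepOp M π)^[t] g s| ≤ C := by
  induction t generalizing s with
  | zero => exact hg s
  | succ t ih =>
    rw [Function.iterate_succ_apply']
    exact abs_stepOp_le hπ ih s

theorem abs_discounted_stepOp_le (hπ : IsPolicy π) {g : S → ℝ} {C : ℝ} (hg : ∀ s, |g s| ≤ C)
    (t : ℕ) (s : S) : |M.γ ^ t * (stepOp M π)^[t] g s| ≤ M.γ ^ t * C := by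
  rw [abs_mul, abs_of_nonneg (pow_nonneg M.γ_pos.le t)]
  exact mul_le_mul_of_nonneg_left (abs_iterate_stepOp_le hπ hg t s) (pow_nonneg M.γ_pos.le t)

theorem hasSum_V (hπ : IsPolicy π) (s : S) :
    HasSum (fun t : ℕ => M.γ ^ t * (stepOp M π)^[t] (stageCost M h π) s) (V M h π s) :=
  (Summable.of_norm_bounded ((summable_geometric_of_lt_one M.γ_pos.le M.γ_lt_one).mul_right _)
    fun t => abs_discounted_stepOp_le hπ (norm_le_pi_norm (stageCost M h π)) t s).hasSum

theorem abs_V_le (hπ : IsPolicy π) {C : ℝ} (hC : ∀ s, |stageCost M h π s| ≤ C) (s : S) :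
    |V M h π s| ≤ C / (1 - M.γ) := by
  have hgeom : HasSum (fun t : ℕ => M.γ ^ t * C) (C / (1 - M.γ)) := by
    rw [div_eq_inv_mul]
    exact (hasSum_geometric_of_lt_one M.γ_pos.le M.γ_lt_one).mul_right C
  rw [V, ← Real.norm_eq_abs]
  exact tsum_of_norm_bounded hgeom fun t => abs_discounted_stepOp_le hπ hC t s

theorem V_eq (hπ : IsPolicy π) (s : S) :
    V M h π s = stageCost M h π s + M.γ * stepOp M π (V M h π) s := by
  have hterm (t : ℕ) : M.γ ^ (t + 1) * (stepOp M π)^[t + 1] (stageCost M h π) s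
      = M.γ * ∑ a, π s a * ∑ s', M.P s a s' *
        (M.γ ^ t * (stepOp M π)^[t] (stageCost M h π) s') := by
    rw [Function.iterate_succ_apply', stepOp, pow_succ', mul_assoc]
    simp only [Finset.mul_sum, mul_left_comm (M.γ ^ t)]
  have hnext : HasSum (fun t : ℕ => M.γ ^ (t + 1) * (stepOp M π)^[t + 1] (stageCost M h π) s)
      (M.γ * stepOp M π (V M h π) s) := by
    simp only [hterm]
    exact (hasSum_sum fun a _ =>
      (hasSum_sum fun s' _ => (hasSum_V hπ s').mul_left _).mul_left _).mul_left _
  have htail := (hasSum_nat_add_iff' 1).2 (hasSum_V (M := M) (h := h) hπ s)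
  rw [hnext.unique htail]
  simp

theorem Q_eq (hπ : IsPolicy π) (s : S) (a : A) :
    Q M h π s a = M.c s a + h s (π s) + M.γ * ∑ s', M.P s a s' * V M h π s' := by
  have hterm (t : ℕ) : M.γ ^ (t + 1) * ∑ s', M.P s a s' * (stepOp M π)^[t] (stageCost M h π) s'
      = M.γ * ∑ s', M.P s a s' * (M.γ ^ t * (stepOp M π)^[t] (stageCost M h π) s') := by
    rw [pow_succ', mul_assoc]
    simp only [Finset.mul_sum, mul_left_comm (M.γ ^ t)]
  simp only [Q, hterm]
  rw [((hasSum_sum fun s' _ => (hasSum_V hπ s').mul_left _).mul_left _).tsum_eq]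

theorem pair_Q_eq (hπ : IsPolicy π) (hπ' : IsPolicy π') (s : S) :
    pair (Q M h π s) (π' s) + h s (π' s) - h s (π s)
      = stageCost M h π' s + M.γ * stepOp M π' (V M h π) s := by
  have hterm (a : A) : Q M h π s a * π' s a
      = π' s a * M.c s a + π' s a * h s (π s)
        + M.γ * (π' s a * ∑ s', M.P s a s' * V M h π s') := by
    rw [Q_eq hπ]
    ring
  simp only [pair, hterm, Finset.sum_add_distrib, ← Finset.sum_mul, ← Finset.mul_sum, (hπ' s).2,
    stageCost, stepOp]
  ring

theorem pair_Q_self (hπ : IsPolicy π) (s : S) : pair (Q M h π s) (π s) = V M h π s := by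
  rw [V_eq hπ s, ← pair_Q_eq hπ hπ, add_sub_cancel_right]

theorem advantage_eq (hπ : IsPolicy π) (hπ' : IsPolicy π') (s : S) :
    pair (Q M h π s) (π' s - π s) + h s (π' s) - h s (π s)
      = V M h π' s - V M h π s
        - M.γ * stepOp M π' (fun s => V M h π' s - V M h π s) s := by
  have hpair := pair_Q_eq (M := M) (h := h) hπ hπ' s
  have hbellman := V_eq (M := M) (h := h) hπ' s
  rw [pair_sub_right, pair_Q_self hπ, stepOp_sub]
  linarith

/-- The contraction is applied at a state maximizing the change of value. -/
theorem V_sub_le (hπ : IsPolicy π) (hπ' : IsPolicy π') {w : S → ℝ} {e : ℝ} (hw : ∀ s, w s ≤ 0)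
    (hadv : ∀ s, pair (Q M h π s) (π' s - π s) + h s (π' s) - h s (π s) ≤ w s + e) (s : S) :
    V M h π' s - V M h π s ≤ w s + e / (1 - M.γ) := by
  have hγ : 0 < 1 - M.γ := sub_pos.2 M.γ_lt_one
  have hstep {C : ℝ} (hC : ∀ s, V M h π' s - V M h π s ≤ C) (s : S) :
      V M h π' s - V M h π s ≤ w s + e + M.γ * C := by
    have hcontract := mul_le_mul_of_nonneg_left (stepOp_le (M := M) hπ' hC s) M.γ_pos.le
    linarith [hadv s, advantage_eq (M := M) (h := h) hπ hπ' s]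
  have : Nonempty S := ⟨s⟩
  obtain ⟨s₀, hs₀⟩ := Finite.exists_max fun s => V M h π' s - V M h π s
  have hmax : V M h π' s₀ - V M h π s₀ ≤ e / (1 - M.γ) := by
    rw [le_div_iff₀ hγ]
    linarith [hstep hs₀ s₀, hw s₀]
  calc V M h π' s - V M h π s ≤ w s + e + M.γ * (e / (1 - M.γ)) :=
        hstep (fun s => (hs₀ s).trans hmax) s
    _ = w s + e / (1 - M.γ) := by field_simp; ring

theorem IsStationary.sum_stepOp {ν : S → ℝ} (hν : IsStationary M π ν) (g : S → ℝ) :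
    ∑ s, ν s * stepOp M π g s = ∑ s, ν s * g s := by
  have hterm (s : S) : ν s * stepOp M π g s = ∑ s', (ν s * ∑ a, π s a * M.P s a s') * g s' := by
    simp only [stepOp, Finset.mul_sum, Finset.sum_mul]
    rw [Finset.sum_comm]
    simp only [mul_assoc]
  simp only [hterm]
  rw [Finset.sum_comm]
  simp only [← Finset.sum_mul, hν.2]

/-- Stationarity turns the discounted operator of the performance difference formula into the
factor `1 - γ`. -/
theorem sum_stationary_advantage {πs : S → A → ℝ} {ν : S → ℝ} (hπ : IsPolicy π)
    (hπs : IsPolicy πs) (hν : IsStationary M πs ν) :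
    ∑ s, ν s * (pair (Q M h π s) (πs s - π s) + h s (πs s) - h s (π s))
      = (1 - M.γ) * (objective M h ν πs - objective M h ν π) := by
  simp only [advantage_eq hπ hπs, mul_sub (ν _) (_ - _), mul_left_comm (ν _) M.γ,
    Finset.sum_sub_distrib, ← Finset.mul_sum, hν.sum_stepOp]
  simp only [objective, mul_sub, Finset.sum_sub_distrib]
  ring

end Value

section Constants

variable {γ μ L : ℝ}

theorem subModulus_eq (hγ : 0 < γ) (hμ : 0 < μ) : subModulus γ μ = 1 / γ := by
  rw [subModulus, stepsize]
  field_simp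
  ring

theorem subModulus_pos (hγ : 0 < γ) (hμ : 0 < μ) : 0 < subModulus γ μ := by
  rw [subModulus_eq hγ hμ]
  positivity

theorem four_mul_subModulus_le : 4 * subModulus γ μ ≤ subSmooth γ μ L :=
  mul_le_mul_of_nonneg_left (le_max_right _ _) (by norm_num)

theorem four_mul_stepsize_le : 4 * (stepsize γ μ * L) ≤ subSmooth γ μ L :=
  mul_le_mul_of_nonneg_left (le_max_left _ _) (by norm_num)

theorem stepsize_pos (hγ : 0 < γ) (hγ1 : γ < 1) (hμ : 0 < μ) : 0 < stepsize γ μ :=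
  div_pos (sub_pos.2 hγ1) (mul_pos hγ hμ)

theorem decay_pos (k : ℕ) : 0 < decay γ k := pow_pos (by norm_num) _

theorem decay_succ_le (k : ℕ) : decay γ (k + 1) ≤ decay γ k :=
  pow_le_pow_of_le_one (by norm_num) (by norm_num)
    (Nat.add_le_add_right (Nat.div_le_div_right (Nat.le_succ k)) 2)

end Constants

section OuterStep

variable {S A : Type*} [Fintype S] [Fintype A] {M : MDP S A} {h : S → (A → ℝ) → ℝ}

theorem abs_pair_sub_le_add_KL {δ p q : A → ℝ} {C β : ℝ} (hδ : ∀ a, |δ a| ≤ C) (hβ : 0 < β)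
    (hp : p ∈ stdSimplex ℝ A) (hq : q ∈ posSimplex A) :
    |pair δ (p - q)| ≤ C ^ 2 / (2 * β) + β * KL p q := by
  have hyoung : C * l1dist p q ≤ C ^ 2 / (2 * β) + β / 2 * l1dist p q ^ 2 := by
    have hsq : C ^ 2 / (2 * β) + β / 2 * l1dist p q ^ 2 - C * l1dist p q
        = (C - β * l1dist p q) ^ 2 / (2 * β) := by
      field_simp
      ring
    have := div_nonneg (sq_nonneg (C - β * l1dist p q)) (by linarith : 0 ≤ 2 * β)
    linarith
  have hpinsker := mul_le_mul_of_nonneg_left (sq_l1dist_le hp hq) (by linarith : 0 ≤ β / 2)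
  linarith [abs_pair_sub_le hδ p q]

theorem pair_sub_le_add_KL_add_KL {δ p p' q : A → ℝ} {C β : ℝ} (hδ : ∀ a, |δ a| ≤ C)
    (hβ : 0 < β) (hp : p ∈ stdSimplex ℝ A) (hp' : p' ∈ stdSimplex ℝ A) (hq : q ∈ posSimplex A) :
    pair δ (p - p') ≤ β * KL p' q + 3 / 2 * β * KL p q + 5 / (6 * β) * C ^ 2 := by
  have hp'_le := (abs_le.1 (abs_pair_sub_le_add_KL hδ hβ hp' hq)).1
  have hp_le := (abs_le.1 (abs_pair_sub_le_add_KL hδ (by linarith : 0 < 3 / 2 * β) hp hq)).2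
  have hconst : C ^ 2 / (2 * β) + C ^ 2 / (2 * (3 / 2 * β)) = 5 / (6 * β) * C ^ 2 := by
    field_simp
    ring
  rw [pair_sub_right] at hp'_le hp_le ⊢
  linarith

theorem abs_apply_le_norm (δ : S → A → ℝ) (s : S) (a : A) : |δ s a| ≤ ‖δ‖ :=
  (norm_le_pi_norm (δ s) a).trans (norm_le_pi_norm δ s)

/-- `(π', v')` solves the mirror descent subproblems `min_p ⟨g s, p⟩ + h s p + β D_{v s}^p` up to an
error `e`: the policy `π'` is `e`-optimal, and `v'` is a second approximate solution from which the
excess of every competitor `p` over the minimum dominates `c D_{v' s}^p`. -/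
def IsInexactUpdate (h : S → (A → ℝ) → ℝ) (g : S → A → ℝ) (β c e : ℝ) (v π' v' : S → A → ℝ) :
    Prop :=
  ∀ s, ∀ p ∈ stdSimplex ℝ A,
    pair (g s) (π' s) + h s (π' s) + β * KL (π' s) (v s) + c * KL p (v' s)
      ≤ pair (g s) p + h s p + β * KL p (v s) + e

/-- The Lyapunov function of the method: the optimality gap of `π` plus `c` times the average
divergence of the optimal policy from the prox-iterate `v`. -/
noncomputable def potential (M : MDP S A) (h : S → (A → ℝ) → ℝ) (ν : S → ℝ) (πs : S → A → ℝ)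
    (c : ℝ) (π v : S → A → ℝ) : ℝ :=
  objective M h ν π - objective M h ν πs + c * avgDist ν v πs

variable {g π v π' v' : S → A → ℝ} {β c e τ : ℝ}

theorem avgDist_nonneg {ν : S → ℝ} {π πs : S → A → ℝ} (hν : ν ∈ stdSimplex ℝ S)
    (hπs : IsPolicy πs) (hπ : ∀ s, π s ∈ posSimplex A) : 0 ≤ avgDist ν π πs :=
  Finset.sum_nonneg fun s _ => mul_nonneg (hν.1 s) (KL_nonneg (hπs s) (hπ s))

theorem IsInexactUpdate.mul_KL_le (hup : IsInexactUpdate h g β c e v π' v') (hβ : 0 ≤ β)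
    (hπ' : IsPolicy π') (hv : ∀ s, v s ∈ posSimplex A) {C : ℝ}
    (hC : ∀ s, ∀ p ∈ stdSimplex ℝ A, |h s p| ≤ C) (s : S) {p : A → ℝ} (hp : p ∈ stdSimplex ℝ A) :
    c * KL p (v' s) ≤ β * KL p (v s) + (2 * ‖g‖ + 2 * C + e) := by
  have hlinear : pair (g s) (p - π' s) ≤ ‖g‖ * 2 :=
    (le_abs_self _).trans ((abs_pair_sub_le (abs_apply_le_norm g s) p (π' s)).trans
      (mul_le_mul_of_nonneg_left (l1dist_le_two hp (hπ' s)) (norm_nonneg g)))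
  rw [pair_sub_right] at hlinear
  have hdist := mul_nonneg hβ (KL_nonneg (hπ' s) (hv s))
  linarith [hup s p hp, le_of_abs_le (hC s p hp), neg_le_of_abs_le (hC s _ (hπ' s))]

theorem IsInexactUpdate.V_sub_le (hup : IsInexactUpdate h g β c e v π' v') (hβ : 0 < β)
    (hc : 0 ≤ c) (hπ : IsPolicy π) (hπ' : IsPolicy π') (hv : ∀ s, v s ∈ posSimplex A)
    (hv' : ∀ s, v' s ∈ posSimplex A) (hτ : ∀ s, KL (π s) (v s) ≤ τ) (s : S) :
    V M h π' s - V M h π s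
      ≤ pair (g s) (π' s - π s) + h s (π' s) - h s (π s) + β * KL (π' s) (v s) - (β * τ + e)
        + (e + 5 / 2 * β * τ + 5 / (6 * β) * ‖g - Q M h π‖ ^ 2) / (1 - M.γ) := by
  refine PMD.V_sub_le (w := fun s => pair (g s) (π' s - π s) + h s (π' s) - h s (π s)
    + β * KL (π' s) (v s) - (β * τ + e)) hπ hπ' (fun s => ?_) (fun s => ?_) s
  · have hupdate := hup s (π s) (hπ s)
    have hdist := mul_nonneg hc (KL_nonneg (hπ s) (hv' s))
    have hclose := mul_le_mul_of_nonneg_left (hτ s) hβ.le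
    rw [pair_sub_right]
    linarith
  · have herror := pair_sub_le_add_KL_add_KL (abs_apply_le_norm (g - Q M h π) s) hβ (hπ s) (hπ' s)
      (hv s)
    have hclose := mul_le_mul_of_nonneg_left (hτ s) (by linarith : 0 ≤ 3 / 2 * β)
    simp only [Pi.sub_apply, pair_sub_left, pair_sub_right] at herror ⊢
    linarith

theorem IsInexactUpdate.V_sub_add_KL_le (hup : IsInexactUpdate h g β c e v π' v') (hβ : 0 < β)
    (hc : 0 ≤ c) (hπ : IsPolicy π) (hπ' : IsPolicy π') (hv : ∀ s, v s ∈ posSimplex A)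
    (hv' : ∀ s, v' s ∈ posSimplex A) (hτ : ∀ s, KL (π s) (v s) ≤ τ) {πs : S → A → ℝ}
    (hπs : IsPolicy πs) (s : S) :
    V M h π' s - V M h π s + c * KL (πs s) (v' s)
      ≤ pair (Q M h π s) (πs s - π s) + h s (πs s) - h s (π s) + β * KL (πs s) (v s)
        - pair (g s - Q M h π s) (π s - πs s)
        + (e + (3 / 2 + M.γ) * (β * τ) + 5 / (6 * β) * ‖g - Q M h π‖ ^ 2) / (1 - M.γ) := by
  have hγ : 0 < 1 - M.γ := sub_pos.2 M.γ_lt_one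
  have hvalue := hup.V_sub_le (M := M) hβ hc hπ hπ' hv hv' hτ s
  have hupdate := hup s (πs s) (hπs s)
  have hconst : (e + 5 / 2 * β * τ + 5 / (6 * β) * ‖g - Q M h π‖ ^ 2) / (1 - M.γ) - β * τ
      = (e + (3 / 2 + M.γ) * (β * τ) + 5 / (6 * β) * ‖g - Q M h π‖ ^ 2) / (1 - M.γ) := by
    rw [div_sub' hγ.ne']
    ring
  simp only [pair_sub_left, pair_sub_right] at hvalue hupdate ⊢
  linarith

theorem IsInexactUpdate.potential_le
    (hup : IsInexactUpdate h g (M.γ * c) c e v π' v') (hc : 0 < c) (hπ : IsPolicy π)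
    (hπ' : IsPolicy π') (hv : ∀ s, v s ∈ posSimplex A) (hv' : ∀ s, v' s ∈ posSimplex A)
    (hτ : ∀ s, KL (π s) (v s) ≤ τ) {πs : S → A → ℝ} {ν : S → ℝ} (hπs : IsPolicy πs)
    (hν : IsStationary M πs ν) :
    potential M h ν πs c π' v' ≤ M.γ * potential M h ν πs c π v
      - ∑ s, ν s * pair (g s - Q M h π s) (π s - πs s)
      + (e + (3 / 2 + M.γ) * (M.γ * c * τ) + 5 / (6 * (M.γ * c)) * ‖g - Q M h π‖ ^ 2)
        / (1 - M.γ) := by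
  set C := (e + (3 / 2 + M.γ) * (M.γ * c * τ) + 5 / (6 * (M.γ * c)) * ‖g - Q M h π‖ ^ 2)
    / (1 - M.γ)
  have hsum := Finset.sum_le_sum fun s (_ : s ∈ Finset.univ) => mul_le_mul_of_nonneg_left
    (hup.V_sub_add_KL_le (M := M) (mul_pos M.γ_pos hc) hc.le hπ hπ' hv hv' hτ hπs s) (hν.1.1 s)
  have hleft : ∑ s, ν s * (V M h π' s - V M h π s + c * KL (πs s) (v' s))
      = objective M h ν π' - objective M h ν π + c * avgDist ν v' πs := by
    simp only [objective, avgDist, mul_add, mul_sub, Finset.sum_add_distrib,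
      Finset.sum_sub_distrib, mul_left_comm (ν _) c, ← Finset.mul_sum]
  have hright : ∑ s, ν s * (pair (Q M h π s) (πs s - π s) + h s (πs s) - h s (π s)
        + M.γ * c * KL (πs s) (v s) - pair (g s - Q M h π s) (π s - πs s) + C)
      = (1 - M.γ) * (objective M h ν πs - objective M h ν π) + M.γ * c * avgDist ν v πs
        - ∑ s, ν s * pair (g s - Q M h π s) (π s - πs s) + C := by
    rw [← sum_stationary_advantage hπ hπs hν]
    simp only [avgDist, mul_add (ν _) _ C, mul_sub (ν _) _ (pair (g _ - Q M h π _) _),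
      mul_add (ν _) _ (M.γ * c * _), Finset.sum_add_distrib, Finset.sum_sub_distrib,
      mul_left_comm (ν _) (M.γ * c), ← Finset.mul_sum, ← Finset.sum_mul, hν.1.2, one_mul]
  rw [hleft, hright] at hsum
  rw [potential, potential]
  linarith

end OuterStep

section Run

variable {S A : Type*} [Fintype S] [Fintype A] {M : MDP S A} {h : S → (A → ℝ) → ℝ}

/-- A realization of policy mirror descent whose subproblems are solved by an unspecified inner
method, the `k`-th policy and prox-iterate being accurate up to `e k`. The last field bounds the
mass that the prox-iterate can put on an action that the policy neglects. -/
structure IsInexactPMD (M : MDP S A) (h : S → (A → ℝ) → ℝ) (c ρ : ℝ) (e : ℕ → ℝ)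
    (Qhat π v : ℕ → S → A → ℝ) : Prop where
  π_zero : π 0 = v 0
  π_mem : ∀ k s, π k s ∈ posSimplex A
  v_mem : ∀ k s, v k s ∈ posSimplex A
  update : ∀ k,
    IsInexactUpdate h (Qhat k) (M.γ * c) c (e (k + 1)) (v k) (π (k + 1)) (v (k + 1))
  mul_v_le : ∀ k s a, ρ * v k s a ≤ π k s a

variable {Qhat π v : ℕ → S → A → ℝ} {c ρ : ℝ} {e : ℕ → ℝ}

theorem IsInexactPMD.isPolicy (hrun : IsInexactPMD M h c ρ e Qhat π v) (k : ℕ) : IsPolicy (π k) :=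
  fun s => (hrun.π_mem k s).1

theorem IsInexactPMD.KL_le (hrun : IsInexactPMD M h c ρ e Qhat π v) (hc : 0 < c)
    (he : 0 ≤ e 0) (k : ℕ) (s : S) : KL (π k s) (v k s) ≤ e k / c := by
  rcases k with _ | k
  · rw [hrun.π_zero, KL_self (hrun.v_mem 0 s)]
    exact div_nonneg he hc.le
  · rw [le_div_iff₀' hc]
    linarith [hrun.update k s (π (k + 1) s) (hrun.π_mem (k + 1) s).1]

theorem IsInexactPMD.potential_succ_le (hrun : IsInexactPMD M h c ρ e Qhat π v) (hc : 0 < c)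
    (he0 : 0 ≤ e 0) (he : Antitone e) {πs : S → A → ℝ} {ν : S → ℝ} (hπs : IsPolicy πs)
    (hν : IsStationary M πs ν) (k : ℕ) :
    potential M h ν πs c (π (k + 1)) (v (k + 1)) ≤ M.γ * potential M h ν πs c (π k) (v k)
      - ∑ s, ν s * pair (Qhat k s - Q M h (π k) s) (π k s - πs s)
      + ((1 + 3 / 2 * M.γ + M.γ ^ 2) * e k
        + 5 / (6 * (M.γ * c)) * ‖Qhat k - Q M h (π k)‖ ^ 2) / (1 - M.γ) := by
  have hγ : 0 < 1 - M.γ := sub_pos.2 M.γ_lt_one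
  refine ((hrun.update k).potential_le hc (hrun.isPolicy k) (hrun.isPolicy (k + 1))
    (hrun.v_mem k) (hrun.v_mem (k + 1)) (hrun.KL_le hc he0 k) hπs hν).trans ?_
  have hτ : M.γ * c * (e k / c) = M.γ * e k := by field_simp
  rw [hτ]
  gcongr
  linarith [he (Nat.le_succ k)]

theorem IsInexactPMD.avgDist_le (hrun : IsInexactPMD M h c ρ e Qhat π v) (hc : 0 < c)
    (he : 0 ≤ e 0) (hρ : 0 < ρ) (hρ1 : ρ ≤ 1) {πs : S → A → ℝ} {ν : S → ℝ} (hπs : IsPolicy πs)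
    (hν : ν ∈ stdSimplex ℝ S) (k : ℕ) :
    avgDist ν (π k) πs
      ≤ (2 - Real.log ρ) * avgDist ν (v k) πs + (4 - 12 * Real.log ρ) * (e k / c) := by
  have hlog : Real.log ρ ≤ 0 := Real.log_nonpos hρ.le hρ1
  have hstate (s : S) : KL (πs s) (π k s) - (2 - Real.log ρ) * KL (πs s) (v k s)
      ≤ (4 - 12 * Real.log ρ) * (e k / c) := by
    have hcompare := KL_le_of_mul_le (hπs s) (hrun.v_mem k s) (hrun.π_mem k s) hρ hρ1
      (hrun.mul_v_le k s)
    have hclose := mul_le_mul_of_nonneg_left (hrun.KL_le hc he k s)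
      (by linarith : 0 ≤ 4 - 12 * Real.log ρ)
    linarith
  have haverage := sum_mul_le_of_mem_stdSimplex hν hstate
  simp only [mul_sub (ν _), Finset.sum_sub_distrib, mul_left_comm (ν _), ← Finset.mul_sum]
    at haverage
  exact sub_le_iff_le_add'.1 haverage

theorem IsInexactPMD.potential_self_le (hrun : IsInexactPMD M h c ρ e Qhat π v) (hc : 0 < c)
    (he : 0 ≤ e 0) (hρ : 0 < ρ) (hρ1 : ρ ≤ 1) {πs : S → A → ℝ} {ν : S → ℝ} (hπs : IsPolicy πs)
    (hν : ν ∈ stdSimplex ℝ S) (k : ℕ) (hgap : objective M h ν πs ≤ objective M h ν (π k)) :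
    potential M h ν πs c (π k) (π k)
      ≤ (2 - Real.log ρ) * potential M h ν πs c (π k) (v k) + (4 - 12 * Real.log ρ) * e k := by
  have hlog : Real.log ρ ≤ 0 := Real.log_nonpos hρ.le hρ1
  have hdist := mul_le_mul_of_nonneg_left (hrun.avgDist_le hc he hρ hρ1 hπs hν k) hc.le
  rw [mul_add c, mul_left_comm c (4 - _), mul_div_cancel₀ _ hc.ne'] at hdist
  have hscale := mul_nonneg (by linarith : 0 ≤ 1 - Real.log ρ) (sub_nonneg.2 hgap)
  rw [potential, potential]
  linarith

end Run

section InnerSolver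

variable {S A : Type*} [Fintype S] [Fintype A] [Nonempty A] {M : MDP S A}
  {h : S → (A → ℝ) → ℝ} {gradh : S → (A → ℝ) → (A → ℝ)} {μ L : ℝ} {R : S → Set (A → ℝ)}
  {T : ℕ → ℕ} {Qhat : ℕ → S → A → ℝ} {π v : ℕ → S → A → ℝ} {x y : ℕ → ℕ → S → A → ℝ}

/-- The error `γ μ (1 - γ) 2^{-(⌊k/l⌋ + 2)} log |A|` to which `T k` admissible accelerated gradient
iterations solve the subproblem that yields the `k`-th policy. -/
noncomputable def updateError (γ μ : ℝ) (n k : ℕ) : ℝ := γ * μ * (1 - γ) * decay γ k * Real.log n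

theorem updateError_nonneg {γ : ℝ} (hγ : 0 < γ) (hγ1 : γ < 1) (hμ : 0 < μ) (n k : ℕ) :
    0 ≤ updateError γ μ n k :=
  mul_nonneg (mul_nonneg (mul_nonneg (mul_pos hγ hμ).le (sub_pos.2 hγ1).le) (decay_pos k).le)
    (Real.log_natCast_nonneg n)

theorem antitone_updateError {γ : ℝ} (hγ : 0 < γ) (hγ1 : γ < 1) (hμ : 0 < μ) (n : ℕ) :
    Antitone (updateError γ μ n) :=
  antitone_nat_of_succ_le fun k => mul_le_mul_of_nonneg_right
    (mul_le_mul_of_nonneg_left (decay_succ_le k) (mul_pos (mul_pos hγ hμ) (sub_pos.2 hγ1)).le)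
    (Real.log_natCast_nonneg n)

theorem IsInexactSPMD.mem_posSimplex (hrun : IsInexactSPMD M gradh μ L T Qhat π v x y)
    (hRpos : ∀ s, R s ⊆ posSimplex A) (hR : ∀ k s, ∀ t ≤ T k, x k t s ∈ R s ∧ y k t s ∈ R s)
    (k : ℕ) (s : S) : π k s ∈ posSimplex A ∧ v k s ∈ posSimplex A := by
  rcases k with _ | k
  · rw [hrun.π_zero, hrun.v_zero]
    exact ⟨uniformPolicy_mem s, uniformPolicy_mem s⟩
  · rw [hrun.π_succ, hrun.v_succ]
    exact (hR k s (T k) le_rfl).symm.imp (fun hy => hRpos s hy) (fun hx => hRpos s hx)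

theorem IsInexactSPMD.mul_v_le (hμ : 0 < μ) (hT : ∀ k, 1 ≤ T k)
    (hrun : IsInexactSPMD M gradh μ L T Qhat π v x y) (k : ℕ) (s : S) (a : A) :
    √(subModulus M.γ μ / subSmooth M.γ μ L) * v k s a ≤ π k s a := by
  have hm := subModulus_pos M.γ_pos hμ
  rcases k with _ | k
  · rw [hrun.π_zero, hrun.v_zero]
    have hle := sqrt_div_le_half hm (four_mul_subModulus_le (L := L))
    exact mul_le_of_le_one_left ((uniformPolicy_mem s).2 a).le (by linarith)
  · rw [hrun.π_succ, hrun.v_succ]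
    exact (hrun.inner k s).mul_x_le_y hm four_mul_subModulus_le (uniformPolicy_mem s).1 (hT k) a

theorem IsInexactSPMD.accuracy (hμ : 0 < μ) (hL : 0 ≤ L) (hh : IsStronglyConvexReg h gradh μ)
    (hS : IsSmoothOn gradh L R) (hT : ∀ k, 1 ≤ T k)
    (hrun : IsInexactSPMD M gradh μ L T Qhat π v x y)
    (hR : ∀ k s, ∀ t ≤ T k, x k t s ∈ R s ∧ y k t s ∈ R s) (k : ℕ) (s : S) {p : A → ℝ}
    (hp : p ∈ stdSimplex ℝ A) :
    stepsize M.γ μ * (pair (Qhat k s) (π (k + 1) s) + h s (π (k + 1) s))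
        + KL (π (k + 1) s) (v k s)
        - (stepsize M.γ μ * (pair (Qhat k s) p + h s p) + KL p (v k s))
        + subModulus M.γ μ * KL p (v (k + 1) s)
      ≤ agdAccuracy (subSmooth M.γ μ L) (subModulus M.γ μ) (T k)
        * KL p (uniformPolicy S A s) := by
  have hη := stepsize_pos M.γ_pos M.γ_lt_one hμ
  have hstrong (q) (hq : q ∈ stdSimplex ℝ A) (q') (hq' : q' ∈ posSimplex A) :
      stepsize M.γ μ * (pair (Qhat k s) q' + h s q')
        + pair (stepsize M.γ μ • (Qhat k s + gradh s q')) (q - q') + stepsize M.γ μ * μ * KL q q'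
      ≤ stepsize M.γ μ * (pair (Qhat k s) q + h s q) := by
    have hreg := mul_le_mul_of_nonneg_left (hh.strong s q hq q' hq') hη.le
    simp only [pair_sub_right, pair_smul_left, pair_add_left] at hreg ⊢
    linarith
  have hlip (q) (hq : q ∈ R s) (q') (hq' : q' ∈ R s) (a : A) :
      |(stepsize M.γ μ • (Qhat k s + gradh s q)) a - (stepsize M.γ μ • (Qhat k s + gradh s q')) a|
        ≤ stepsize M.γ μ * L * l1dist q q' := by
    simp only [Pi.smul_apply, Pi.add_apply, smul_eq_mul, ← mul_sub, add_sub_add_left_eq_sub,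
      abs_mul, abs_of_pos hη, mul_assoc]
    exact mul_le_mul_of_nonneg_left (hS.lipschitz s q hq q' hq' a) hη.le
  have haccuracy := (hrun.inner k s).accuracy (Lφ := stepsize M.γ μ * L) (R := R s)
    (φ := fun q => stepsize M.γ μ * (pair (Qhat k s) q + h s q)) (by positivity)
    four_mul_subModulus_le (by positivity) four_mul_stepsize_le
    (hrun.mem_posSimplex hS.subset hR k s).2 (hS.subset s) (hS.convex s) (hR k s) hstrong hlip hp
    (hT k)
  rwa [← hrun.π_succ, ← hrun.v_succ] at haccuracy

theorem IsInexactSPMD.isInexactUpdate (hμ : 0 < μ) (hL : 0 ≤ L)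
    (hh : IsStronglyConvexReg h gradh μ) (hS : IsSmoothOn gradh L R)
    (hT : AdmissibleSteps M.γ μ L T) (hrun : IsInexactSPMD M gradh μ L T Qhat π v x y)
    (hR : ∀ k s, ∀ t ≤ T k, x k t s ∈ R s ∧ y k t s ∈ R s) (k : ℕ) :
    IsInexactUpdate h (Qhat k) (M.γ * (μ / (1 - M.γ))) (μ / (1 - M.γ))
      (updateError M.γ μ (Fintype.card A) (k + 1)) (v k) (π (k + 1)) (v (k + 1)) := by
  intro s p hp
  have hγ := M.γ_pos
  have hγ1 : 0 < 1 - M.γ := sub_pos.2 M.γ_lt_one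
  have hβη : M.γ * (μ / (1 - M.γ)) * stepsize M.γ μ = 1 := by
    rw [stepsize]
    field_simp
  have hβm : M.γ * (μ / (1 - M.γ)) * subModulus M.γ μ = μ / (1 - M.γ) := by
    rw [subModulus_eq hγ hμ]
    field_simp
  have hβe : M.γ * (μ / (1 - M.γ)) * ((1 - M.γ) ^ 2 * decay M.γ (k + 1)
      * Real.log (Fintype.card A)) = updateError M.γ μ (Fintype.card A) (k + 1) := by
    rw [updateError]
    field_simp
  have herror := mul_le_mul (hT k).2 (KL_uniformPolicy_le s hp)
    (KL_nonneg hp (uniformPolicy_mem s)) (mul_pos (pow_pos hγ1 2) (decay_pos (k + 1))).le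
  have hscaled := mul_le_mul_of_nonneg_left
    ((hrun.accuracy hμ hL hh hS (fun k => (hT k).1) hR k s hp).trans herror)
    (by positivity : 0 ≤ M.γ * (μ / (1 - M.γ)))
  rw [hβe] at hscaled
  generalize M.γ * (μ / (1 - M.γ)) = β at hβη hβm hscaled ⊢
  rw [← hβm]
  linear_combination hscaled + hβη * (pair (Qhat k s) p + h s p
    - pair (Qhat k s) (π (k + 1) s) - h s (π (k + 1) s))

theorem IsInexactSPMD.isInexactPMD (hμ : 0 < μ) (hL : 0 ≤ L)
    (hh : IsStronglyConvexReg h gradh μ) (hS : IsSmoothOn gradh L R)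
    (hT : AdmissibleSteps M.γ μ L T) (hrun : IsInexactSPMD M gradh μ L T Qhat π v x y)
    (hR : ∀ k s, ∀ t ≤ T k, x k t s ∈ R s ∧ y k t s ∈ R s) :
    IsInexactPMD M h (μ / (1 - M.γ)) √(subModulus M.γ μ / subSmooth M.γ μ L)
      (updateError M.γ μ (Fintype.card A)) Qhat π v where
  π_zero := hrun.π_zero.trans hrun.v_zero.symm
  π_mem k s := (hrun.mem_posSimplex hS.subset hR k s).1
  v_mem k s := (hrun.mem_posSimplex hS.subset hR k s).2
  update := hrun.isInexactUpdate hμ hL hh hS hT hR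
  mul_v_le := hrun.mul_v_le hμ fun k => (hT k).1

end InnerSolver

section Measurability

theorem exists_forall_abs_le_on_stdSimplex {S A : Type*} [Finite S] [Fintype A]
    {g : S → (A → ℝ) → ℝ}
    (hg : ∀ s, ContinuousOn (g s) (stdSimplex ℝ A)) :
    ∃ C, ∀ s, ∀ p ∈ stdSimplex ℝ A, |g s p| ≤ C := by
  have := Fintype.ofFinite S
  choose C hC using fun s => (isCompact_stdSimplex ℝ A).exists_bound_of_continuousOn (hg s)
  exact ⟨‖C‖, fun s p hp => (hC s p hp).trans ((le_abs_self _).trans (norm_le_pi_norm C s))⟩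

variable {S A Ω : Type*} [Fintype S] [Fintype A] [MeasurableSpace Ω] {M : MDP S A}
  {h : S → (A → ℝ) → ℝ} {π : Ω → S → A → ℝ}

theorem exists_forall_abs_V_le (hh : ∀ s, ContinuousOn (h s) (stdSimplex ℝ A)) :
    ∃ C, ∀ π : S → A → ℝ, IsPolicy π → ∀ s, |V M h π s| ≤ C := by
  obtain ⟨C, hC⟩ := exists_forall_abs_le_on_stdSimplex
    (g := fun s p => ∑ a, p a * M.c s a + h s p)
    fun s => (by fun_prop : Continuous fun p : A → ℝ => ∑ a, p a * M.c s a).continuousOn.add (hh s)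
  exact ⟨C / (1 - M.γ), fun π hπ s => abs_V_le hπ (fun s => hC s _ (hπ s)) s⟩

theorem exists_forall_abs_Q_le (hh : ∀ s, ContinuousOn (h s) (stdSimplex ℝ A)) :
    ∃ C, ∀ π : S → A → ℝ, IsPolicy π → ∀ s a, |Q M h π s a| ≤ C := by
  obtain ⟨CV, hCV⟩ := exists_forall_abs_V_le (M := M) hh
  obtain ⟨Ch, hCh⟩ := exists_forall_abs_le_on_stdSimplex hh
  refine ⟨‖M.c‖ + Ch + M.γ * CV, fun π hπ s a => ?_⟩
  rw [Q_eq hπ]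
  refine (abs_add_three _ _ _).trans
    (add_le_add_three (abs_apply_le_norm M.c s a) (hCh s _ (hπ s)) ?_)
  rw [abs_mul, abs_of_pos M.γ_pos]
  exact mul_le_mul_of_nonneg_left (abs_sum_mul_le_of_mem_stdSimplex (M.P_mem s a) (hCV π hπ))
    M.γ_pos.le

theorem measurable_comp_of_continuousOn_stdSimplex {g : (A → ℝ) → ℝ}
    (hg : ContinuousOn g (stdSimplex ℝ A)) {p : Ω → A → ℝ} (hp : ∀ ω, p ω ∈ stdSimplex ℝ A)
    (hpm : ∀ a, Measurable fun ω => p ω a) : Measurable fun ω => g (p ω) :=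
  (continuousOn_iff_continuous_domRestrict.1 hg).measurable.comp
    ((measurable_pi_lambda p hpm).subtype_mk (h := hp))

theorem measurable_stepOp (hπm : ∀ s a, Measurable fun ω => π ω s a) {g : Ω → S → ℝ}
    (hg : ∀ s, Measurable fun ω => g ω s) (s : S) :
    Measurable fun ω => stepOp M (π ω) (g ω) s :=
  Finset.measurable_fun_sum _ fun a _ => (hπm s a).mul
    (Finset.measurable_fun_sum _ fun s' _ => (hg s').const_mul _)

theorem measurable_iterate_stepOp (hh : ∀ s, ContinuousOn (h s) (stdSimplex ℝ A))
    (hπ : ∀ ω, IsPolicy (π ω)) (hπm : ∀ s a, Measurable fun ω => π ω s a) (t : ℕ) (s : S) :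
    Measurable fun ω => (stepOp M (π ω))^[t] (stageCost M h (π ω)) s := by
  induction t generalizing s with
  | zero =>
    exact (Finset.measurable_fun_sum _ fun a _ => (hπm s a).mul_const _).add
      (measurable_comp_of_continuousOn_stdSimplex (hh s) (fun ω => hπ ω s) (hπm s))
  | succ t ih =>
    simp only [Function.iterate_succ_apply']
    exact measurable_stepOp hπm ih s

theorem measurable_V (hh : ∀ s, ContinuousOn (h s) (stdSimplex ℝ A))
    (hπ : ∀ ω, IsPolicy (π ω)) (hπm : ∀ s a, Measurable fun ω => π ω s a) (s : S) :
    Measurable fun ω => V M h (π ω) s :=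
  Measurable.tsum fun t => (measurable_iterate_stepOp hh hπ hπm t s).const_mul _

theorem measurable_Q (hh : ∀ s, ContinuousOn (h s) (stdSimplex ℝ A))
    (hπ : ∀ ω, IsPolicy (π ω)) (hπm : ∀ s a, Measurable fun ω => π ω s a) :
    Measurable fun ω => Q M h (π ω) :=
  measurable_pi_lambda _ fun s => measurable_pi_lambda _ fun _ => (measurable_const.add
    (measurable_comp_of_continuousOn_stdSimplex (hh s) (fun ω => hπ ω s) (hπm s))).add
    (Measurable.tsum fun t => (Finset.measurable_fun_sum _ fun s' _ =>
      (measurable_iterate_stepOp hh hπ hπm t s').const_mul _).const_mul _)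

theorem measurable_KL (p : A → ℝ) {q : Ω → A → ℝ} (hqm : ∀ a, Measurable fun ω => q ω a) :
    Measurable fun ω => KL p (q ω) :=
  Finset.measurable_fun_sum _ fun a _ =>
    (Real.measurable_log.comp ((hqm a).const_div (p a))).const_mul _

end Measurability

section ConditionalBias

variable {Ω : Type*} {m₀ m : MeasurableSpace Ω} {ℙ : Measure Ω}

theorem integral_sub_mul_eq_integral_condExp_sub_mul [IsFiniteMeasure ℙ] {X Y W : Ω → ℝ} {C : ℝ}
    (hm : m₀ ≤ m) (hX : Integrable X ℙ) (hY : Integrable Y ℙ) (hW : StronglyMeasurable[m₀] W)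
    (hWC : ∀ ω, |W ω| ≤ C) :
    ∫ ω, (X ω - Y ω) * W ω ∂ℙ = ∫ ω, ((ℙ[X | m₀]) ω - Y ω) * W ω ∂ℙ := by
  have hmul {Z : Ω → ℝ} (hZ : Integrable Z ℙ) : Integrable (fun ω => Z ω * W ω) ℙ :=
    hZ.mul_bdd (hW.mono hm).aestronglyMeasurable (ae_of_all _ hWC)
  have hpull : ∫ ω, X ω * W ω ∂ℙ = ∫ ω, (ℙ[X | m₀]) ω * W ω ∂ℙ :=
    (integral_condExp hm).symm.trans
      (integral_congr_ae (condExp_mul_of_stronglyMeasurable_right hW (hmul hX) hX))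
  simp only [sub_mul]
  rw [integral_sub (hmul hX) (hmul hY), integral_sub (hmul integrable_condExp) (hmul hY), hpull]

theorem abs_integral_sum_sub_mul_le [IsProbabilityMeasure ℙ] {ι : Type*} [Fintype ι]
    {X Y W : ι → Ω → ℝ} {ς C : ℝ} (hm : m₀ ≤ m) (hX : ∀ i, Integrable (X i) ℙ)
    (hY : ∀ i, Integrable (Y i) ℙ) (hW : ∀ i, StronglyMeasurable[m₀] (W i)) (hς : 0 ≤ ς)
    (hbias : ∀ i, ∀ᵐ ω ∂ℙ, |(ℙ[X i | m₀]) ω - Y i ω| ≤ ς) (hWC : ∀ ω, ∑ i, |W i ω| ≤ C) :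
    |∫ ω, ∑ i, (X i ω - Y i ω) * W i ω ∂ℙ| ≤ ς * C := by
  have hWi (i : ι) (ω : Ω) : |W i ω| ≤ C := (Finset.single_le_sum
    (f := fun i => |W i ω|) (fun _ _ => abs_nonneg _) (Finset.mem_univ i)).trans (hWC ω)
  have hmul {Z : Ω → ℝ} (hZ : Integrable Z ℙ) (i : ι) : Integrable (fun ω => Z ω * W i ω) ℙ :=
    hZ.mul_bdd ((hW i).mono hm).aestronglyMeasurable (ae_of_all _ (hWi i))
  have hcond : ∫ ω, ∑ i, (X i ω - Y i ω) * W i ω ∂ℙ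
      = ∫ ω, ∑ i, ((ℙ[X i | m₀]) ω - Y i ω) * W i ω ∂ℙ := by
    have hleft (i : ι) : Integrable (fun ω => (X i ω - Y i ω) * W i ω) ℙ :=
      hmul ((hX i).sub (hY i)) i
    have hright (i : ι) : Integrable (fun ω => ((ℙ[X i | m₀]) ω - Y i ω) * W i ω) ℙ :=
      hmul (integrable_condExp.sub (hY i)) i
    rw [integral_finsetSum _ fun i _ => hleft i, integral_finsetSum _ fun i _ => hright i]
    exact Finset.sum_congr rfl fun i _ =>
      integral_sub_mul_eq_integral_condExp_sub_mul hm (hX i) (hY i) (hW i) (hWi i)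
  rw [hcond, ← Real.norm_eq_abs]
  refine (norm_integral_le_of_norm_le_const (C := ς * C) ?_).trans_eq (by simp)
  filter_upwards [ae_all_iff.2 hbias] with ω hω
  calc ‖∑ i, ((ℙ[X i | m₀]) ω - Y i ω) * W i ω‖
      ≤ ∑ i, ς * |W i ω| := norm_sum_le_of_le _ fun i _ => by
        rw [norm_mul]
        exact mul_le_mul_of_nonneg_right (hω i) (abs_nonneg _)
    _ ≤ ς * C := by
        rw [← Finset.mul_sum]
        exact mul_le_mul_of_nonneg_left (hWC ω) hς

end ConditionalBias

section StochasticRun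

variable {S A Ω : Type*} [Fintype S] [Fintype A] [m : MeasurableSpace Ω]

theorem IsOptimal.objective_le {M : MDP S A} {h : S → (A → ℝ) → ℝ} {π πs : S → A → ℝ}
    {ν : S → ℝ} (hπs : IsOptimal M h πs) (hν : ν ∈ stdSimplex ℝ S) (hπ : IsPolicy π) :
    objective M h ν πs ≤ objective M h ν π :=
  Finset.sum_le_sum fun s _ => mul_le_mul_of_nonneg_left (hπs.2 π hπ s) (hν.1 s)

/-- A random realization of inexact policy mirror descent with a deterministic initial policy, whose
estimators have conditional bias at most `ς k` and conditional mean square error at most `σsq k`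
given the information `ℱ k` that determines the `k`-th policy. -/
structure IsStochasticPMD (ℙ : Measure Ω) (ℱ : Filtration ℕ m) (M : MDP S A)
    (h : S → (A → ℝ) → ℝ) (c ρ : ℝ) (e ς σsq : ℕ → ℝ) (Qhat π v : ℕ → Ω → S → A → ℝ) : Prop where
  isPolicy : ∀ k ω, IsPolicy (π k ω)
  v_zero : ∃ v₀, ∀ ω, v 0 ω = v₀
  run : ∀ᵐ ω ∂ℙ, IsInexactPMD M h c ρ e (fun k => Qhat k ω) (fun k => π k ω) (fun k => v k ω)
  adapted : ∀ k s a, StronglyMeasurable[ℱ k] (fun ω => π k ω s a) ∧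
    StronglyMeasurable[ℱ k] (fun ω => v k ω s a)
  estimator : IsEstimator ℙ ℱ M h ς σsq Qhat π

namespace IsStochasticPMD

variable {ℙ : Measure Ω} {ℱ : Filtration ℕ m} {M : MDP S A} {h : S → (A → ℝ) → ℝ} {c ρ : ℝ}
  {e ς σsq : ℕ → ℝ} {Qhat π v : ℕ → Ω → S → A → ℝ} {πs : S → A → ℝ} {ν : S → ℝ}

theorem measurable_π (H : IsStochasticPMD ℙ ℱ M h c ρ e ς σsq Qhat π v) (k : ℕ) (s : S) (a : A) :
    Measurable fun ω => π k ω s a :=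
  ((H.adapted k s a).1.mono (ℱ.le k)).measurable

theorem measurable_v (H : IsStochasticPMD ℙ ℱ M h c ρ e ς σsq Qhat π v) (k : ℕ) (s : S) (a : A) :
    Measurable fun ω => v k ω s a :=
  ((H.adapted k s a).2.mono (ℱ.le k)).measurable

theorem measurable_Qhat (H : IsStochasticPMD ℙ ℱ M h c ρ e ς σsq Qhat π v) (k : ℕ) :
    Measurable (Qhat k) :=
  measurable_pi_lambda _ fun s => measurable_pi_lambda _ fun a =>
    ((H.estimator.measurable k s a).mono (ℱ.le _)).measurable

variable [IsProbabilityMeasure ℙ]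

theorem integral_sq_norm_sub_le (H : IsStochasticPMD ℙ ℱ M h c ρ e ς σsq Qhat π v) (k : ℕ) :
    ∫ ω, ‖Qhat k ω - Q M h (π k ω)‖ ^ 2 ∂ℙ ≤ σsq k := by
  rw [← integral_condExp (ℱ.le k)]
  refine (integral_mono_ae integrable_condExp (integrable_const _)
    (H.estimator.error k)).trans_eq ?_
  rw [integral_const, probReal_univ, one_smul]

theorem integrable_objective (H : IsStochasticPMD ℙ ℱ M h c ρ e ς σsq Qhat π v)
    (hh : ∀ s, ContinuousOn (h s) (stdSimplex ℝ A)) (k : ℕ) :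
    Integrable (fun ω => objective M h ν (π k ω)) ℙ := by
  obtain ⟨C, hC⟩ := exists_forall_abs_V_le (M := M) hh
  exact integrable_finsetSum _ fun s _ => Integrable.const_mul (Integrable.of_bound
    (measurable_V hh (H.isPolicy k) (H.measurable_π k) s).aestronglyMeasurable C
    (ae_of_all _ fun ω => hC _ (H.isPolicy k ω) s)) _

theorem integrable_Q (H : IsStochasticPMD ℙ ℱ M h c ρ e ς σsq Qhat π v)
    (hh : ∀ s, ContinuousOn (h s) (stdSimplex ℝ A)) (k : ℕ) :
    Integrable (fun ω => Q M h (π k ω)) ℙ := by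
  obtain ⟨C, hC⟩ := exists_forall_abs_Q_le (M := M) hh
  exact Integrable.of_eval fun s => Integrable.of_eval fun a => Integrable.of_bound
    (measurable_pi_iff.1 (measurable_pi_iff.1
      (measurable_Q hh (H.isPolicy k) (H.measurable_π k)) s) a).aestronglyMeasurable C
    (ae_of_all _ fun ω => hC _ (H.isPolicy k ω) s a)

theorem integrable_Qhat (H : IsStochasticPMD ℙ ℱ M h c ρ e ς σsq Qhat π v)
    (hh : ∀ s, ContinuousOn (h s) (stdSimplex ℝ A)) (k : ℕ) : Integrable (Qhat k) ℙ := by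
  have hQ := H.integrable_Q hh k
  have herror : MemLp (Qhat k - fun ω => Q M h (π k ω)) 2 ℙ :=
    (memLp_two_iff_integrable_sq_norm ((H.measurable_Qhat k).aestronglyMeasurable.sub
      hQ.aestronglyMeasurable)).2 (H.estimator.integrable k)
  simpa only [sub_add_cancel] using (herror.integrable one_le_two).add hQ

theorem integrable_KL (H : IsStochasticPMD ℙ ℱ M h c ρ e ς σsq Qhat π v) (hc : 0 < c)
    (hh : ∀ s, ContinuousOn (h s) (stdSimplex ℝ A)) (k : ℕ) (s : S) {p : A → ℝ}
    (hp : p ∈ stdSimplex ℝ A) : Integrable (fun ω => KL p (v k ω s)) ℙ := by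
  induction k with
  | zero =>
    obtain ⟨v₀, hv₀⟩ := H.v_zero
    simp only [hv₀]
    exact integrable_const _
  | succ k ih =>
    obtain ⟨C, hC⟩ := exists_forall_abs_le_on_stdSimplex hh
    have hbound := (ih.const_mul (M.γ * c)).add ((((H.integrable_Qhat hh k).norm.const_mul 2).add
      (integrable_const (2 * C))).add (integrable_const (e (k + 1))))
    rw [← integrable_const_mul_iff (IsUnit.mk0 c hc.ne')]
    refine hbound.mono'
      ((measurable_KL p (H.measurable_v (k + 1) s)).const_mul _).aestronglyMeasurable ?_
    filter_upwards [H.run] with ω hω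
    rw [Real.norm_of_nonneg (mul_nonneg hc.le (KL_nonneg hp (hω.v_mem (k + 1) s)))]
    exact (hω.update k).mul_KL_le (mul_pos M.γ_pos hc).le (hω.isPolicy (k + 1)) (hω.v_mem k) hC s
      hp

theorem integrable_avgDist_v (H : IsStochasticPMD ℙ ℱ M h c ρ e ς σsq Qhat π v) (hc : 0 < c)
    (hh : ∀ s, ContinuousOn (h s) (stdSimplex ℝ A)) (hπs : IsPolicy πs) (k : ℕ) :
    Integrable (fun ω => avgDist ν (v k ω) πs) ℙ :=
  integrable_finsetSum _ fun s _ => (H.integrable_KL hc hh k s (hπs s)).const_mul _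

theorem integrable_avgDist_π (H : IsStochasticPMD ℙ ℱ M h c ρ e ς σsq Qhat π v) (hc : 0 < c)
    (he : 0 ≤ e 0) (hρ : 0 < ρ) (hρ1 : ρ ≤ 1) (hh : ∀ s, ContinuousOn (h s) (stdSimplex ℝ A))
    (hπs : IsPolicy πs) (hν : ν ∈ stdSimplex ℝ S) (k : ℕ) :
    Integrable (fun ω => avgDist ν (π k ω) πs) ℙ := by
  refine (((H.integrable_avgDist_v (ν := ν) hc hh hπs k).const_mul (2 - Real.log ρ)).add
    (integrable_const ((4 - 12 * Real.log ρ) * (e k / c)))).mono'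
    (Finset.measurable_fun_sum _ fun s _ =>
      (measurable_KL (πs s) (H.measurable_π k s)).const_mul _).aestronglyMeasurable ?_
  filter_upwards [H.run] with ω hω
  rw [Real.norm_of_nonneg (avgDist_nonneg hν hπs (hω.π_mem k))]
  exact hω.avgDist_le hc he hρ hρ1 hπs hν k

theorem integrable_potential (H : IsStochasticPMD ℙ ℱ M h c ρ e ς σsq Qhat π v) (hc : 0 < c)
    (hh : ∀ s, ContinuousOn (h s) (stdSimplex ℝ A)) (hπs : IsPolicy πs) (k : ℕ) :
    Integrable (fun ω => potential M h ν πs c (π k ω) (v k ω)) ℙ :=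
  ((H.integrable_objective hh k).sub (integrable_const _)).add
    ((H.integrable_avgDist_v hc hh hπs k).const_mul _)

theorem integrable_potential_self (H : IsStochasticPMD ℙ ℱ M h c ρ e ς σsq Qhat π v) (hc : 0 < c)
    (he : 0 ≤ e 0) (hρ : 0 < ρ) (hρ1 : ρ ≤ 1) (hh : ∀ s, ContinuousOn (h s) (stdSimplex ℝ A))
    (hπs : IsPolicy πs) (hν : ν ∈ stdSimplex ℝ S) (k : ℕ) :
    Integrable (fun ω => potential M h ν πs c (π k ω) (π k ω)) ℙ :=
  ((H.integrable_objective hh k).sub (integrable_const _)).add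
    ((H.integrable_avgDist_π hc he hρ hρ1 hh hπs hν k).const_mul _)

theorem abs_integral_pair_sub_le (H : IsStochasticPMD ℙ ℱ M h c ρ e ς σsq Qhat π v)
    (hh : ∀ s, ContinuousOn (h s) (stdSimplex ℝ A)) (hς : ∀ k, 0 ≤ ς k) (hπs : IsPolicy πs)
    (k : ℕ) (s : S) :
    |∫ ω, pair (Qhat k ω s - Q M h (π k ω) s) (π k ω s - πs s) ∂ℙ| ≤ ς k * 2 :=
  abs_integral_sum_sub_mul_le (ℱ.le k) (fun a => ((H.integrable_Qhat hh k).eval s).eval a)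
    (fun a => ((H.integrable_Q hh k).eval s).eval a)
    (fun a => (H.adapted k s a).1.sub stronglyMeasurable_const) (hς k) (H.estimator.bias k s)
    fun ω => l1dist_le_two (H.isPolicy k ω s) (hπs s)

theorem integrable_pair_sub (H : IsStochasticPMD ℙ ℱ M h c ρ e ς σsq Qhat π v)
    (hh : ∀ s, ContinuousOn (h s) (stdSimplex ℝ A)) (πs : S → A → ℝ) (k : ℕ) (s : S) :
    Integrable (fun ω => pair (Qhat k ω s - Q M h (π k ω) s) (π k ω s - πs s)) ℙ :=
  integrable_finsetSum _ fun a _ =>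
    ((((H.integrable_Qhat hh k).sub (H.integrable_Q hh k)).eval s).eval a).mul_bdd
      (c := 1 + |πs s a|)
      ((H.measurable_π k s a).sub_const (πs s a)).aestronglyMeasurable
      (ae_of_all _ fun ω => (norm_sub_le _ _).trans (add_le_add_left
        ((Real.norm_of_nonneg ((H.isPolicy k ω s).1 a)).trans_le
          (mem_Icc_of_mem_stdSimplex (H.isPolicy k ω s) a).2) _))

theorem integral_potential_succ_le (H : IsStochasticPMD ℙ ℱ M h c ρ e ς σsq Qhat π v)
    (hc : 0 < c) (he0 : 0 ≤ e 0) (he : Antitone e)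
    (hh : ∀ s, ContinuousOn (h s) (stdSimplex ℝ A)) (hς : ∀ k, 0 ≤ ς k) (hπs : IsPolicy πs)
    (hν : IsStationary M πs ν) (k : ℕ) :
    ∫ ω, potential M h ν πs c (π (k + 1) ω) (v (k + 1) ω) ∂ℙ
      ≤ M.γ * ∫ ω, potential M h ν πs c (π k ω) (v k ω) ∂ℙ
        + (((1 + 3 / 2 * M.γ + M.γ ^ 2) * e k + 5 / (6 * (M.γ * c)) * σsq k) / (1 - M.γ)
          + ς k * 2) := by
  have hγ := M.γ_pos
  have hγ1 : 0 < 1 - M.γ := sub_pos.2 M.γ_lt_one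
  have hpotential := (H.integrable_potential (ν := ν) hc hh hπs k).const_mul M.γ
  have hpair (s : S) := (H.integrable_pair_sub hh πs k s).const_mul (ν s)
  have hbiasInt := integrable_finsetSum Finset.univ fun s _ => hpair s
  have hsq := (H.estimator.integrable k).const_mul (5 / (6 * (M.γ * c)))
  have herrorInt := ((integrable_const ((1 + 3 / 2 * M.γ + M.γ ^ 2) * e k)).add hsq).div_const
    (1 - M.γ)
  have hbias : -(ς k * 2) ≤ ∑ s, ν s *
      ∫ ω, pair (Qhat k ω s - Q M h (π k ω) s) (π k ω s - πs s) ∂ℙ :=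
    neg_le_of_abs_le (abs_sum_mul_le_of_mem_stdSimplex hν.1
      fun s => H.abs_integral_pair_sub_le hh hς hπs k s)
  have herror : ((1 + 3 / 2 * M.γ + M.γ ^ 2) * e k
        + 5 / (6 * (M.γ * c)) * ∫ ω, ‖Qhat k ω - Q M h (π k ω)‖ ^ 2 ∂ℙ) / (1 - M.γ)
      ≤ ((1 + 3 / 2 * M.γ + M.γ ^ 2) * e k + 5 / (6 * (M.γ * c)) * σsq k) / (1 - M.γ) := by
    gcongr
    exact H.integral_sq_norm_sub_le k
  have hstep := integral_mono_ae (H.integrable_potential (ν := ν) hc hh hπs (k + 1))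
    ((hpotential.sub hbiasInt).add herrorInt)
    (H.run.mono fun ω hω => hω.potential_succ_le hc he0 he hπs hν k)
  rw [integral_add' (hpotential.sub hbiasInt) herrorInt, integral_sub' hpotential hbiasInt,
    integral_const_mul, integral_finsetSum _ fun s _ => hpair s, integral_div,
    integral_add' (integrable_const _) hsq] at hstep
  simp only [integral_const, probReal_univ, one_smul, integral_const_mul] at hstep
  linarith

theorem integral_potential_self_le (H : IsStochasticPMD ℙ ℱ M h c ρ e ς σsq Qhat π v)
    (hc : 0 < c) (he : 0 ≤ e 0) (hρ : 0 < ρ) (hρ1 : ρ ≤ 1)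
    (hh : ∀ s, ContinuousOn (h s) (stdSimplex ℝ A)) (hπs : IsOptimal M h πs)
    (hν : ν ∈ stdSimplex ℝ S) (k : ℕ) :
    ∫ ω, potential M h ν πs c (π k ω) (π k ω) ∂ℙ
      ≤ (2 - Real.log ρ) * ∫ ω, potential M h ν πs c (π k ω) (v k ω) ∂ℙ
        + (4 - 12 * Real.log ρ) * e k := by
  have hpotential :=
    (H.integrable_potential (ν := ν) hc hh hπs.1 k).const_mul (2 - Real.log ρ)
  have hle := integral_mono_ae (H.integrable_potential_self hc he hρ hρ1 hh hπs.1 hν k)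
    (hpotential.add (integrable_const ((4 - 12 * Real.log ρ) * e k)))
    (H.run.mono fun ω hω => hω.potential_self_le hc he hρ hρ1 hπs.1 hν k
      (hπs.objective_le hν (H.isPolicy k ω)))
  rw [integral_add' hpotential (integrable_const _), integral_const_mul] at hle
  simpa only [integral_const, probReal_univ, one_smul] using hle

theorem integral_gap_le_integral_potential
    (H : IsStochasticPMD ℙ ℱ M h c ρ e ς σsq Qhat π v) (hc : 0 < c)
    (hh : ∀ s, ContinuousOn (h s) (stdSimplex ℝ A)) (hπs : IsPolicy πs)
    (hν : ν ∈ stdSimplex ℝ S) (k : ℕ) :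
    ∫ ω, (objective M h ν (π k ω) - objective M h ν πs) ∂ℙ
      ≤ ∫ ω, potential M h ν πs c (π k ω) (v k ω) ∂ℙ :=
  integral_mono_ae ((H.integrable_objective hh k).sub (integrable_const _))
    (H.integrable_potential hc hh hπs k) (H.run.mono fun _ hω =>
      le_add_of_nonneg_right (mul_nonneg hc.le (avgDist_nonneg hν hπs (hω.v_mem k))))

end IsStochasticPMD

end StochasticRun

section EpochRecursion

variable {X : ℕ → ℝ} {γ B c : ℝ} {l : ℕ}

theorem le_within_epoch_of_recursion (hγ : 0 ≤ γ) (hc : 3 * c ≤ (1 - γ) * B)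
    (hstep : ∀ k, X (k + 1) ≤ γ * X k + c * (1 / 2) ^ (k / l)) {i : ℕ}
    (hi : X (l * i) ≤ (1 / 2) ^ i * B) {j : ℕ} (hj : j ≤ l) :
    X (l * i + j) ≤ (1 / 2) ^ i * (γ ^ j * B + (1 - γ ^ j) * B / 3) := by
  induction j with
  | zero => simpa using hi
  | succ j ih =>
    have hepoch : (l * i + j) / l = i := by
      rw [Nat.mul_add_div (by lia), Nat.div_eq_of_lt hj, add_zero]
    calc X (l * i + j + 1) ≤ γ * X (l * i + j) + c * (1 / 2) ^ i := by
          simpa only [hepoch] using hstep (l * i + j)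
      _ ≤ γ * ((1 / 2) ^ i * (γ ^ j * B + (1 - γ ^ j) * B / 3))
          + (1 - γ) * B / 3 * (1 / 2) ^ i := by
          gcongr
          · exact ih (Nat.le_of_succ_le hj)
          · linarith
      _ = (1 / 2) ^ i * (γ ^ (j + 1) * B + (1 - γ ^ (j + 1)) * B / 3) := by ring

theorem le_half_pow_mul_of_recursion (hγ : 0 ≤ γ) (hγ1 : γ ≤ 1) (hl : γ ^ l ≤ 1 / 4)
    (hB : 0 ≤ B) (h0 : X 0 ≤ B) (hc : 3 * c ≤ (1 - γ) * B)
    (hstep : ∀ k, X (k + 1) ≤ γ * X k + c * (1 / 2) ^ (k / l)) (k : ℕ) :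
    X k ≤ (1 / 2) ^ (k / l) * B := by
  have hlpos : 0 < l := Nat.pos_of_ne_zero fun h => by norm_num [h] at hl
  have hepochs (i : ℕ) : X (l * i) ≤ (1 / 2) ^ i * B := by
    induction i with
    | zero => simpa using h0
    | succ i ih =>
      refine (le_within_epoch_of_recursion hγ hc hstep ih le_rfl).trans ?_
      rw [pow_succ, mul_assoc]
      refine mul_le_mul_of_nonneg_left ?_ (by positivity)
      linarith [mul_le_mul_of_nonneg_right hl hB]
  have hwithin := le_within_epoch_of_recursion hγ hc hstep (hepochs (k / l))
    (Nat.mod_lt k hlpos).le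
  rw [Nat.div_add_mod] at hwithin
  refine hwithin.trans (mul_le_mul_of_nonneg_left ?_ (by positivity))
  linarith [mul_le_mul_of_nonneg_right (pow_le_one₀ (n := k % l) hγ hγ1) hB]

end EpochRecursion

section RateConstants

variable {γ μ L gap : ℝ}

theorem epochLen_pos (hγ : 0 < γ) (hγ1 : γ < 1) : 0 < epochLen γ :=
  Nat.ceil_pos.2 (Real.logb_pos_of_base_lt_one hγ hγ1 (by norm_num) (by norm_num))

theorem pow_epochLen_le (hγ : 0 < γ) (hγ1 : γ < 1) : γ ^ epochLen γ ≤ 1 / 4 := by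
  rw [← Real.rpow_natCast]
  exact (Real.rpow_le_rpow_of_exponent_ge hγ hγ1.le (Nat.le_ceil _)).trans_eq
    (Real.rpow_logb hγ hγ1.ne (by norm_num))

theorem decay_eq (k : ℕ) : decay γ k = (1 / 2) ^ (k / epochLen γ) / 4 := by
  rw [decay, pow_add]
  ring

theorem mul_one_sub_sq_le_one (hγ : 0 < γ) (hγ1 : γ < 1) : γ * (1 - γ) ^ 2 ≤ 1 :=
  mul_le_one₀ hγ1.le (sq_nonneg _) (pow_le_one₀ (sub_pos.2 hγ1).le (by linarith))

theorem subSmooth_eq (hγ : 0 < γ) (hμ : 0 < μ) :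
    subSmooth γ μ L = 4 * condNumber γ μ L * subModulus γ μ := by
  rw [subSmooth, condNumber, mul_assoc 4, max_mul_of_nonneg _ _ (subModulus_pos hγ hμ).le, one_mul,
    max_comm]
  congr 2
  rw [subModulus_eq hγ hμ, stepsize]
  field_simp

theorem one_le_condNumber : 1 ≤ condNumber γ μ L := le_max_left _ _

theorem condNumber_pos : 0 < condNumber γ μ L := one_pos.trans_le one_le_condNumber

theorem sqrt_subModulus_div (hγ : 0 < γ) (hμ : 0 < μ) :
    √(subModulus γ μ / subSmooth γ μ L) = 1 / (2 * √(condNumber γ μ L)) := by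
  have hm := subModulus_pos hγ hμ
  have hκ := condNumber_pos (γ := γ) (μ := μ) (L := L)
  have hratio : subModulus γ μ / subSmooth γ μ L = 1 / (2 ^ 2 * condNumber γ μ L) := by
    rw [subSmooth_eq hγ hμ]
    field_simp
    norm_num
  rw [hratio, Real.sqrt_div zero_le_one, Real.sqrt_one, Real.sqrt_mul (by norm_num),
    Real.sqrt_sq (by norm_num)]

theorem log_sqrt_subModulus_div (hγ : 0 < γ) (hμ : 0 < μ) :
    Real.log √(subModulus γ μ / subSmooth γ μ L)
      = -(Real.log 2 + Real.log (condNumber γ μ L) / 2) := by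
  rw [sqrt_subModulus_div hγ hμ, one_div, Real.log_inv,
    Real.log_mul (by norm_num) (Real.sqrt_pos.2 condNumber_pos).ne',
    Real.log_sqrt condNumber_pos.le]

theorem one_sub_mul_rateConst (hγ1 : γ < 1) (n : ℕ) :
    (1 - γ) * rateConst γ μ gap n = (1 - γ) * gap + (μ * Real.log n + 5 * (2 - γ) / 2
      + 5 / (8 * γ * μ) + 5 * μ * γ ^ 2 * (1 + γ) * Real.log n / 4) := by
  have h1γ : 1 - γ ≠ 0 := (sub_pos.2 hγ1).ne'
  rw [rateConst]
  field_simp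

theorem rateConst_pos (hγ : 0 < γ) (hγ1 : γ < 1) (hμ : 0 < μ) (hgap : 0 ≤ gap) (n : ℕ) :
    0 < rateConst γ μ gap n := by
  have h1γ := sub_pos.2 hγ1
  have := Real.log_natCast_nonneg n
  have hconst : 0 < 5 * (2 - γ) / 2 := by linarith
  refine pos_of_mul_pos_right ?_ h1γ.le
  rw [one_sub_mul_rateConst hγ1]
  positivity

theorem gap_add_le_rateConst (hγ : 0 < γ) (hγ1 : γ < 1) (hμ : 0 < μ) (n : ℕ) :
    gap + μ / (1 - γ) * Real.log n ≤ rateConst γ μ gap n := by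
  have h1γ := sub_pos.2 hγ1
  have := Real.log_natCast_nonneg n
  have : 0 < 5 * (2 - γ) / 2 := by linarith
  have hrest : 0 ≤ 5 / (8 * γ * μ) + 5 * μ * γ ^ 2 * (1 + γ) * Real.log n / 4 := by positivity
  refine le_of_mul_le_mul_left ?_ h1γ
  rw [one_sub_mul_rateConst hγ1, mul_add, ← mul_assoc, mul_div_cancel₀ _ h1γ.ne']
  linarith

/-- The constant `c` in the recursion `Φₖ₊₁ ≤ γ Φₖ + c 2^{-⌊k/l⌋}` for the expected potentials,
where `n = |A|`; its terms stem from the inner solver, the variance and the bias. -/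
noncomputable def errorConst (γ μ : ℝ) (n : ℕ) : ℝ :=
  (γ * μ * (1 + 3 / 2 * γ + γ ^ 2) * Real.log n + 5 / (6 * γ * μ) + 2 * (1 - γ)) / 4

theorem errorConst_mul_half_pow (hγ1 : γ < 1) (n k : ℕ) :
    errorConst γ μ n * (1 / 2) ^ (k / epochLen γ)
      = ((1 + 3 / 2 * γ + γ ^ 2) * updateError γ μ n k
        + 5 / (6 * (γ * (μ / (1 - γ)))) * decay γ k) / (1 - γ) + (1 - γ) * decay γ k * 2 := by
  have h1γ : 1 - γ ≠ 0 := (sub_pos.2 hγ1).ne'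
  rw [errorConst, updateError, decay_eq]
  field_simp

theorem three_mul_errorConst_le (hγ : 0 < γ) (hγ1 : γ < 1) (hμ : 0 < μ) (hgap : 0 ≤ gap)
    (n : ℕ) : 3 * errorConst γ μ n ≤ (1 - γ) * rateConst γ μ gap n := by
  have hlog := mul_nonneg hμ.le (Real.log_natCast_nonneg n)
  have hgap' := mul_nonneg (sub_pos.2 hγ1).le hgap
  have hlogcoef : 0 ≤ μ * Real.log n * (4 - 3 * γ + γ ^ 2 / 2 + 2 * γ ^ 3) :=
    mul_nonneg hlog (by linarith [pow_pos hγ 2, pow_pos hγ 3])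
  have hvariance : 3 * (5 / (6 * γ * μ)) = 4 * (5 / (8 * γ * μ)) := by
    field_simp
    norm_num
  rw [one_sub_mul_rateConst hγ1, errorConst]
  linarith

theorem updateError_le (hγ : 0 < γ) (hγ1 : γ < 1) (hμ : 0 < μ) (n k : ℕ) :
    updateError γ μ n k
      ≤ (1 / 2) ^ (k / epochLen γ) * (μ / (1 - γ) * Real.log n) / 4 := by
  have h1γ := sub_pos.2 hγ1
  have := Real.log_natCast_nonneg n
  calc updateError γ μ n k = γ * (1 - γ) ^ 2
        * ((1 / 2) ^ (k / epochLen γ) * (μ / (1 - γ) * Real.log n) / 4) := by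
        rw [updateError, decay_eq]
        field_simp
    _ ≤ _ := mul_le_of_le_one_left (by positivity) (mul_one_sub_sq_le_one hγ hγ1)

theorem half_pow_epochs_mul_le {B ε : ℝ} (hB : 0 < B) (hε : 0 < ε) :
    (1 / 2) ^ epochs B ε * B ≤ ε := by
  have hpow : B / ε ≤ 2 ^ epochs B ε := by
    rw [← Real.rpow_natCast, ← Real.logb_le_iff_le_rpow (by norm_num) (by positivity)]
    exact Nat.le_ceil _
  rw [one_div, inv_pow, inv_mul_le_iff₀ (by positivity)]
  exact (div_le_iff₀ hε).1 hpow

end RateConstants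

section Convergence

variable {S A Ω : Type*} [Fintype S] [Fintype A] [m : MeasurableSpace Ω] {ℙ : Measure Ω}
  [IsProbabilityMeasure ℙ] {ℱ : Filtration ℕ m} {M : MDP S A} {h : S → (A → ℝ) → ℝ} {μ L : ℝ}
  {Qhat π v : ℕ → Ω → S → A → ℝ} {πs : S → A → ℝ} {ν : S → ℝ} {ρ B : ℝ}

theorem IsOptimal.gap_uniformPolicy_nonneg [Nonempty A] (hπs : IsOptimal M h πs)
    (hν : ν ∈ stdSimplex ℝ S) :
    0 ≤ objective M h ν (uniformPolicy S A) - objective M h ν πs :=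
  sub_nonneg.2 (hπs.objective_le hν fun s => (uniformPolicy_mem s).1)

theorem IsStochasticPMD.integral_potential_zero_le [Nonempty A] {c : ℝ} {e ς σsq : ℕ → ℝ}
    (H : IsStochasticPMD ℙ ℱ M h c ρ e ς σsq Qhat π v) (hc : 0 < c)
    (hh : ∀ s, ContinuousOn (h s) (stdSimplex ℝ A)) (hv : ∀ ω, v 0 ω = uniformPolicy S A)
    (hπs : IsPolicy πs) (hν : ν ∈ stdSimplex ℝ S) :
    ∫ ω, potential M h ν πs c (π 0 ω) (v 0 ω) ∂ℙ
      ≤ objective M h ν (uniformPolicy S A) - objective M h ν πs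
        + c * Real.log (Fintype.card A) := by
  refine (integral_mono_ae (H.integrable_potential hc hh hπs 0) (integrable_const _)
    (H.run.mono fun ω hω => ?_)).trans_eq (by rw [integral_const, probReal_univ, one_smul])
  have hπ : π 0 ω = uniformPolicy S A := hω.π_zero.trans (hv ω)
  simp only [hπ, hv ω]
  exact add_le_add_right (mul_le_mul_of_nonneg_left
    (sum_mul_le_of_mem_stdSimplex hν fun s => KL_uniformPolicy_le s (hπs s)) hc.le) _

theorem IsStochasticPMD.integral_potential_le [Nonempty A]
    (H : IsStochasticPMD ℙ ℱ M h (μ / (1 - M.γ)) ρ (updateError M.γ μ (Fintype.card A))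
      (fun k => (1 - M.γ) * decay M.γ k) (decay M.γ) Qhat π v) (hμ : 0 < μ)
    (hh : ∀ s, ContinuousOn (h s) (stdSimplex ℝ A)) (hv : ∀ ω, v 0 ω = uniformPolicy S A)
    (hπs : IsOptimal M h πs) (hν : IsStationary M πs ν)
    (hB : B = rateConst M.γ μ (objective M h ν (uniformPolicy S A) - objective M h ν πs)
      (Fintype.card A)) (k : ℕ) :
    ∫ ω, potential M h ν πs (μ / (1 - M.γ)) (π k ω) (v k ω) ∂ℙ
      ≤ (1 / 2) ^ (k / epochLen M.γ) * B := by
  have hγ := M.γ_pos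
  have hγ1 := M.γ_lt_one
  have hc := div_pos hμ (sub_pos.2 hγ1)
  have hgap := hπs.gap_uniformPolicy_nonneg hν.1
  subst hB
  refine le_half_pow_mul_of_recursion
    (X := fun k => ∫ ω, potential M h ν πs (μ / (1 - M.γ)) (π k ω) (v k ω) ∂ℙ) hγ.le hγ1.le
    (pow_epochLen_le hγ hγ1) (rateConst_pos hγ hγ1 hμ hgap _).le
    ((H.integral_potential_zero_le hc hh hv hπs.1 hν.1).trans (gap_add_le_rateConst hγ hγ1 hμ _))
    (three_mul_errorConst_le hγ hγ1 hμ hgap (Fintype.card A)) (fun k => ?_) k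
  rw [errorConst_mul_half_pow hγ1]
  exact H.integral_potential_succ_le hc (updateError_nonneg hγ hγ1 hμ _ 0)
    (antitone_updateError hγ hγ1 hμ _) hh
    (fun k => (mul_pos (sub_pos.2 hγ1) (decay_pos k)).le) hπs.1 hν k

theorem IsStochasticPMD.integral_policy_potential_le [Nonempty A]
    (H : IsStochasticPMD ℙ ℱ M h (μ / (1 - M.γ)) √(subModulus M.γ μ / subSmooth M.γ μ L)
      (updateError M.γ μ (Fintype.card A)) (fun k => (1 - M.γ) * decay M.γ k) (decay M.γ)
      Qhat π v) (hμ : 0 < μ)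
    (hh : ∀ s, ContinuousOn (h s) (stdSimplex ℝ A)) (hv : ∀ ω, v 0 ω = uniformPolicy S A)
    (hπs : IsOptimal M h πs) (hν : IsStationary M πs ν)
    (hB : B = rateConst M.γ μ (objective M h ν (uniformPolicy S A) - objective M h ν πs)
      (Fintype.card A)) (k : ℕ) :
    ∫ ω, potential M h ν πs (μ / (1 - M.γ)) (π k ω) (π k ω) ∂ℙ
      ≤ 20 * (1 + Real.log (condNumber M.γ μ L)) * ((1 / 2) ^ (k / epochLen M.γ) * B) := by
  have hγ := M.γ_pos
  have hγ1 := M.γ_lt_one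
  have hm := subModulus_pos hγ hμ
  have hgap := hπs.gap_uniformPolicy_nonneg hν.1
  have hpolicy := H.integral_potential_self_le (div_pos hμ (sub_pos.2 hγ1))
    (updateError_nonneg hγ hγ1 hμ _ 0) (sqrt_div_pos hm four_mul_subModulus_le)
    ((sqrt_div_le_half hm four_mul_subModulus_le).trans (by norm_num)) hh hπs hν.1 k
  rw [log_sqrt_subModulus_div hγ hμ] at hpolicy
  have hprox := H.integral_potential_le hμ hh hv hπs hν hB k
  have herror : updateError M.γ μ (Fintype.card A) k ≤ (1 / 2) ^ (k / epochLen M.γ) * B / 4 := by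
    refine (updateError_le hγ hγ1 hμ (Fintype.card A) k).trans ?_
    gcongr
    exact (le_add_of_nonneg_left hgap).trans ((gap_add_le_rateConst hγ hγ1 hμ _).trans_eq hB.symm)
  have hW : 0 ≤ (1 / 2) ^ (k / epochLen M.γ) * B :=
    mul_nonneg (by positivity) (hB ▸ (rateConst_pos hγ hγ1 hμ hgap (Fintype.card A)).le)
  generalize (1 / 2) ^ (k / epochLen M.γ) * B = W at hprox herror hW ⊢
  have hlogκ : 0 ≤ Real.log (condNumber M.γ μ L) := Real.log_nonneg one_le_condNumber
  have hlog2 := Real.log_two_gt_d9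
  have hlog2' := Real.log_two_lt_d9
  calc _ ≤ _ := hpolicy
    _ ≤ (2 + (Real.log 2 + Real.log (condNumber M.γ μ L) / 2)) * W
        + (4 + 12 * (Real.log 2 + Real.log (condNumber M.γ μ L) / 2)) * (W / 4) := by
        simp only [mul_neg, sub_neg_eq_add]
        gcongr
    _ = (3 + 4 * Real.log 2 + 2 * Real.log (condNumber M.γ μ L)) * W := by ring
    _ ≤ _ := mul_le_mul_of_nonneg_right (by linarith) hW

theorem IsStochasticPMD.integral_gap_le [Nonempty A]
    (H : IsStochasticPMD ℙ ℱ M h (μ / (1 - M.γ)) ρ (updateError M.γ μ (Fintype.card A))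
      (fun k => (1 - M.γ) * decay M.γ k) (decay M.γ) Qhat π v) (hμ : 0 < μ)
    (hh : ∀ s, ContinuousOn (h s) (stdSimplex ℝ A)) (hv : ∀ ω, v 0 ω = uniformPolicy S A)
    (hπs : IsOptimal M h πs) (hν : IsStationary M πs ν)
    (hB : B = rateConst M.γ μ (objective M h ν (uniformPolicy S A) - objective M h ν πs)
      (Fintype.card A)) {ε : ℝ} (hε : 0 < ε) :
    ∫ ω, (objective M h ν (π (epochLen M.γ * epochs B ε) ω) - objective M h ν πs) ∂ℙ ≤ ε := by
  have hc := div_pos hμ (sub_pos.2 M.γ_lt_one)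
  have hB0 : 0 < B := hB ▸ rateConst_pos M.γ_pos M.γ_lt_one hμ
    (hπs.gap_uniformPolicy_nonneg hν.1) (Fintype.card A)
  have hpotential := H.integral_potential_le hμ hh hv hπs hν hB (epochLen M.γ * epochs B ε)
  rw [Nat.mul_div_cancel_left _ (epochLen_pos M.γ_pos M.γ_lt_one)] at hpotential
  exact (H.integral_gap_le_integral_potential hc hh hπs.1 hν.1 _).trans
    (hpotential.trans (half_pow_epochs_mul_le hB0 hε))

theorem IsInexactSPMD.isPolicy [Nonempty A] {gradh : S → (A → ℝ) → (A → ℝ)} {T : ℕ → ℕ}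
    {Qhat π v : ℕ → S → A → ℝ} {x y : ℕ → ℕ → S → A → ℝ} (hμ : 0 < μ)
    (hrun : IsInexactSPMD M gradh μ L T Qhat π v x y) (k : ℕ) : IsPolicy (π k) := by
  intro s
  rcases k with _ | k
  · rw [hrun.π_zero]
    exact (uniformPolicy_mem s).1
  · rw [hrun.π_succ]
    exact (hrun.inner k s).y_mem (subModulus_pos M.γ_pos hμ) four_mul_subModulus_le
      (uniformPolicy_mem s).1 le_rfl

omit [IsProbabilityMeasure ℙ] in
theorem isStochasticPMD_of_isInexactSPMD [Nonempty A] {gradh : S → (A → ℝ) → (A → ℝ)}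
    {R : S → Set (A → ℝ)} {T : ℕ → ℕ} {x y : ℕ → ℕ → Ω → S → A → ℝ} {ς σsq : ℕ → ℝ}
    (hμ : 0 < μ) (hL : 0 ≤ L) (hh : IsStronglyConvexReg h gradh μ) (hS : IsSmoothOn gradh L R)
    (hT : AdmissibleSteps M.γ μ L T)
    (hrun : ∀ ω, IsInexactSPMD M gradh μ L T (fun k => Qhat k ω) (fun k => π k ω)
      (fun k => v k ω) (fun k t => x k t ω) (fun k t => y k t ω))
    (hR : ∀ᵐ ω ∂ℙ, ∀ k s, ∀ t ≤ T k, x k t ω s ∈ R s ∧ y k t ω s ∈ R s)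
    (hadapted : ∀ k s a, StronglyMeasurable[ℱ k] (fun ω => π k ω s a) ∧
      StronglyMeasurable[ℱ k] (fun ω => v k ω s a))
    (hest : IsEstimator ℙ ℱ M h ς σsq Qhat π) :
    IsStochasticPMD ℙ ℱ M h (μ / (1 - M.γ)) √(subModulus M.γ μ / subSmooth M.γ μ L)
      (updateError M.γ μ (Fintype.card A)) ς σsq Qhat π v where
  isPolicy k ω := (hrun ω).isPolicy hμ k
  v_zero := ⟨_, fun ω => (hrun ω).v_zero⟩
  run := hR.mono fun ω hω => (hrun ω).isInexactPMD hμ hL hh hS hT hω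
  adapted := hadapted
  estimator := hest

end Convergence

section Complexity

variable {γ μ L : ℝ}

theorem agdAccuracy_le_of_log_le {Λ m τ : ℝ} (hm : 0 < m) (hΛ : 4 * m ≤ Λ) (hτ : 0 < τ) {n : ℕ}
    (hn : Real.log (2 * Λ / τ) / √(m / Λ) ≤ n) : agdAccuracy Λ m (n + 1) ≤ τ := by
  have hα := sqrt_div_pos hm hΛ
  have hα2 := sqrt_div_le_half hm hΛ
  have hΛ0 : 0 < Λ := by linarith
  rw [div_le_iff₀ hα] at hn
  have hpow : (1 - √(m / Λ)) ^ n ≤ τ / (2 * Λ) := by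
    calc (1 - √(m / Λ)) ^ n ≤ Real.exp (-√(m / Λ)) ^ n :=
          pow_le_pow_left₀ (by linarith) (Real.one_sub_le_exp_neg _) n
      _ = Real.exp (-(n * √(m / Λ))) := by rw [← Real.exp_nat_mul, mul_neg]
      _ ≤ Real.exp (-Real.log (2 * Λ / τ)) := Real.exp_le_exp.2 (neg_le_neg hn)
      _ = τ / (2 * Λ) := by rw [Real.exp_neg, Real.exp_log (by positivity), inv_div]
  rw [agdAccuracy, Nat.add_sub_cancel]
  exact (mul_le_mul_of_nonneg_left ((min_le_left _ _).trans hpow) (by positivity)).trans_eq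
    (mul_div_cancel₀ τ (by positivity))

theorem ceil_mem_steps (hγ : 0 < γ) (hγ1 : γ < 1) (hμ : 0 < μ) (k : ℕ) :
    ⌈Real.log (2 * subSmooth γ μ L / ((1 - γ) ^ 2 * decay γ (k + 1)))
        / √(subModulus γ μ / subSmooth γ μ L)⌉₊ + 1 ∈
      {t : ℕ | 1 ≤ t ∧
        agdAccuracy (subSmooth γ μ L) (subModulus γ μ) t ≤ (1 - γ) ^ 2 * decay γ (k + 1)} :=
  ⟨Nat.le_add_left _ _, agdAccuracy_le_of_log_le (subModulus_pos hγ hμ) four_mul_subModulus_le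
    (mul_pos (pow_pos (sub_pos.2 hγ1) 2) (decay_pos _)) (Nat.le_ceil _)⟩

theorem admissibleSteps_leastSteps (hγ : 0 < γ) (hγ1 : γ < 1) (hμ : 0 < μ) :
    AdmissibleSteps γ μ L (leastSteps γ μ L) :=
  fun k => Nat.sInf_mem ⟨_, ceil_mem_steps hγ hγ1 hμ k⟩

theorem log_condNumber_div_nonneg (hγ : 0 < γ) (hγ1 : γ < 1) :
    0 ≤ Real.log (condNumber γ μ L / (γ * (1 - γ) ^ 2)) :=
  Real.log_nonneg ((one_le_div (mul_pos hγ (pow_pos (sub_pos.2 hγ1) 2))).2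
    ((mul_one_sub_sq_le_one hγ hγ1).trans one_le_condNumber))

theorem log_subSmooth_div_le (hγ : 0 < γ) (hγ1 : γ < 1) (hμ : 0 < μ) {k n : ℕ}
    (hk : k < epochLen γ * n) :
    Real.log (2 * subSmooth γ μ L / ((1 - γ) ^ 2 * decay γ (k + 1)))
      ≤ 5 * n + Real.log (condNumber γ μ L / (γ * (1 - γ) ^ 2)) := by
  have h1γ := sub_pos.2 hγ1
  have hκ := condNumber_pos (γ := γ) (μ := μ) (L := L)
  have hn : (1 : ℝ) ≤ n := Nat.one_le_cast.2 (pos_of_mul_pos_right (Nat.zero_lt_of_lt hk) (by simp))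
  have hsmooth : 2 * subSmooth γ μ L = 8 * condNumber γ μ L / γ := by
    rw [subSmooth_eq hγ hμ, subModulus_eq hγ hμ]
    ring
  have hdecay : (1 / 2 : ℝ) ^ (n + 2) ≤ decay γ (k + 1) :=
    pow_le_pow_of_le_one (by norm_num) (by norm_num)
      (Nat.add_le_add_right (Nat.div_le_of_le_mul hk) 2)
  calc Real.log (2 * subSmooth γ μ L / ((1 - γ) ^ 2 * decay γ (k + 1)))
      ≤ Real.log (8 * condNumber γ μ L / γ / ((1 - γ) ^ 2 * (1 / 2) ^ (n + 2))) := by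
        rw [hsmooth]
        have hd := decay_pos (γ := γ) (k + 1)
        gcongr
    _ = Real.log (2 ^ (n + 5) * (condNumber γ μ L / (γ * (1 - γ) ^ 2))) := by
        congr 1
        rw [one_div, inv_pow, pow_add, pow_add]
        field_simp
        norm_num
    _ = (n + 5) * Real.log 2 + Real.log (condNumber γ μ L / (γ * (1 - γ) ^ 2)) := by
        rw [Real.log_mul (by positivity) (by positivity), Real.log_pow]
        push_cast
        ring
    _ ≤ _ := by
        have hlog2 := mul_le_mul_of_nonneg_left Real.log_two_lt_d9.le
          (by positivity : 0 ≤ n + (5 : ℝ))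
        linarith

theorem leastSteps_le (hγ : 0 < γ) (hγ1 : γ < 1) (hμ : 0 < μ) {k n : ℕ}
    (hk : k < epochLen γ * n) :
    (leastSteps γ μ L k : ℝ) ≤ 20 * √(condNumber γ μ L)
      * (n + Real.log (condNumber γ μ L / (γ * (1 - γ) ^ 2))) := by
  have hn : (1 : ℝ) ≤ n := Nat.one_le_cast.2 (pos_of_mul_pos_right (Nat.zero_lt_of_lt hk) (by simp))
  have hlog := log_subSmooth_div_le (L := L) hγ hγ1 hμ hk
  have hW := log_condNumber_div_nonneg (μ := μ) (L := L) hγ hγ1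
  have hleast : leastSteps γ μ L k ≤ _ := Nat.sInf_le (ceil_mem_steps (L := L) hγ hγ1 hμ k)
  rw [sqrt_subModulus_div hγ hμ, div_div_eq_mul_div, div_one] at hleast
  have hsqrt : 1 ≤ √(condNumber γ μ L) := Real.one_le_sqrt.2 one_le_condNumber
  have hone : 1 ≤ √(condNumber γ μ L) * n := one_le_mul_of_one_le_of_one_le hsqrt hn
  set W := Real.log (condNumber γ μ L / (γ * (1 - γ) ^ 2))
  have hceil : (⌈Real.log (2 * subSmooth γ μ L / ((1 - γ) ^ 2 * decay γ (k + 1)))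
        * (2 * √(condNumber γ μ L))⌉₊ : ℝ) ≤ (5 * n + W) * (2 * √(condNumber γ μ L)) + 1 :=
    (Nat.cast_le.2 (Nat.ceil_mono (mul_le_mul_of_nonneg_right hlog (by positivity)))).trans
      (Nat.ceil_lt_add_one (by positivity)).le
  have hleast' : (leastSteps γ μ L k : ℝ) ≤ _ := Nat.cast_le.2 hleast
  push_cast at hleast'
  linarith [mul_nonneg (zero_le_one.trans hsqrt) hW]

theorem gradEvals_le (hγ : 0 < γ) (hγ1 : γ < 1) (hμ : 0 < μ) (n : ℕ) :
    (gradEvals (leastSteps γ μ L) (epochLen γ * n) : ℝ)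
      ≤ 20 * (epochLen γ * n) * √(condNumber γ μ L)
        * (n + Real.log (condNumber γ μ L / (γ * (1 - γ) ^ 2))) := by
  rw [gradEvals, Nat.cast_sum]
  refine (Finset.sum_le_card_nsmul _ _ _ fun k hk =>
    leastSteps_le hγ hγ1 hμ (Finset.mem_range.1 hk)).trans_eq ?_
  rw [Finset.card_range, nsmul_eq_mul]
  push_cast
  ring

theorem epochs_le {B ε : ℝ} (hB : 0 < B) (hε : 0 < ε) (hlog : 1 ≤ Real.log (1 / ε)) :
    (epochs B ε : ℝ) ≤ ((|Real.log B| + 1) / Real.log 2 + 1) * Real.log (1 / ε) := by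
  have : 0 < Real.log 2 := Real.log_pos one_lt_two
  have hlogB := abs_nonneg (Real.log B)
  have hlogb : Real.logb 2 (B / ε) ≤ (|Real.log B| + 1) / Real.log 2 * Real.log (1 / ε) := by
    rw [Real.logb, div_mul_eq_mul_div, div_eq_mul_one_div B, Real.log_mul hB.ne' (by positivity)]
    gcongr
    nlinarith [le_abs_self (Real.log B)]
  have hceil : (epochs B ε : ℝ) ≤ (|Real.log B| + 1) / Real.log 2 * Real.log (1 / ε) + 1 :=
    (Nat.cast_le.2 (Nat.ceil_mono hlogb)).trans (Nat.ceil_lt_add_one (by positivity)).le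
  linarith

theorem isBigO_gradEvals (hγ : 0 < γ) (hγ1 : γ < 1) (hμ : 0 < μ) {B : ℝ} (hB : 0 < B) :
    (fun ε : ℝ => (gradEvals (leastSteps γ μ L) (epochLen γ * epochs B ε) : ℝ))
      =O[𝓝[>] 0] (fun ε : ℝ => Real.logb γ ε * √(condNumber γ μ L) * Real.log (1 / ε)) := by
  have hW := log_condNumber_div_nonneg (μ := μ) (L := L) hγ hγ1
  set W := Real.log (condNumber γ μ L / (γ * (1 - γ) ^ 2))
  set c := (|Real.log B| + 1) / Real.log 2 + 1
  have hlogγ := Real.log_neg hγ hγ1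
  have hneglogγ := neg_pos.2 hlogγ
  refine Asymptotics.IsBigO.of_bound (20 * epochLen γ * c * (c + W) * -Real.log γ) ?_
  filter_upwards [Ioo_mem_nhdsGT (Real.exp_pos (-1))] with ε hε
  have hlog : 1 ≤ Real.log (1 / ε) := by
    rw [one_div, Real.log_inv, le_neg, Real.log_le_iff_le_exp hε.1]
    exact hε.2.le
  have hlogb : Real.logb γ ε = Real.log (1 / ε) / -Real.log γ := by
    rw [Real.logb, one_div, Real.log_inv, neg_div_neg_eq]
  have hepochs := epochs_le hB hε.1 hlog
  rw [hlogb, Real.norm_of_nonneg (Nat.cast_nonneg _)]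
  set ℓ := Real.log (1 / ε)
  rw [Real.norm_of_nonneg (by positivity)]
  calc (gradEvals (leastSteps γ μ L) (epochLen γ * epochs B ε) : ℝ)
      ≤ 20 * (epochLen γ * epochs B ε) * √(condNumber γ μ L) * (epochs B ε + W) :=
        gradEvals_le hγ hγ1 hμ (epochs B ε)
    _ ≤ 20 * (epochLen γ * (c * ℓ)) * √(condNumber γ μ L) * (c * ℓ + W * ℓ) := by
        gcongr
        exact le_mul_of_one_le_right hW hlog
    _ = _ := by
        have hne := hlogγ.ne
        field_simp

end Complexity

end PMD

theorem mainTheorem11 {S A Ω : Type*} [Fintype S] [Fintype A]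
    [m : MeasurableSpace Ω] (ℙ : Measure Ω) [IsProbabilityMeasure ℙ]
    (M : MDP S A) (h : S → (A → ℝ) → ℝ) (gradh : S → (A → ℝ) → (A → ℝ))
    (μ L : ℝ) (hμ : 0 < μ) (hL : 0 ≤ L)
    (hh : IsStronglyConvexReg h gradh μ)
    (πs : S → A → ℝ) (hπs : IsOptimal M h πs)
    (νs : S → ℝ) (hνs : IsStationary M πs νs)
    (f : (S → A → ℝ) → ℝ) (hf : f = objective M h νs)
    (B : ℝ) (hB : B = rateConst M.γ μ (f (uniformPolicy S A) - f πs) (Fintype.card A)) :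
    (∀ (R : S → Set (A → ℝ)) (ℱ : Filtration ℕ m) (T : ℕ → ℕ)
        (Qhat : ℕ → Ω → S → A → ℝ) (π v : ℕ → Ω → S → A → ℝ) (x y : ℕ → ℕ → Ω → S → A → ℝ),
      IsSmoothOn gradh L R →
      AdmissibleSteps M.γ μ L T →
      (∀ ω, IsInexactSPMD M gradh μ L T (fun k => Qhat k ω) (fun k => π k ω) (fun k => v k ω)
        (fun k t => x k t ω) (fun k t => y k t ω)) →
      (∀ᵐ ω ∂ℙ, ∀ k s, ∀ t ≤ T k, x k t ω s ∈ R s ∧ y k t ω s ∈ R s) →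
      (∀ k s a, StronglyMeasurable[ℱ k] (fun ω => π k ω s a) ∧
        StronglyMeasurable[ℱ k] (fun ω => v k ω s a)) →
      IsEstimator ℙ ℱ M h (fun k => (1 - M.γ) * decay M.γ k) (fun k => decay M.γ k) Qhat π →
      (∀ k,
        Integrable (fun ω => f (π k ω) - f πs + μ / (1 - M.γ) * avgDist νs (v k ω) πs) ℙ ∧
        ∫ ω, (f (π k ω) - f πs + μ / (1 - M.γ) * avgDist νs (v k ω) πs) ∂ℙ
          ≤ (1 / 2) ^ (k / epochLen M.γ) * B ∧
        Integrable (fun ω => f (π k ω) - f πs + μ / (1 - M.γ) * avgDist νs (π k ω) πs) ℙ ∧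
        ∫ ω, (f (π k ω) - f πs + μ / (1 - M.γ) * avgDist νs (π k ω) πs) ∂ℙ
          ≤ 20 * (1 + Real.log (condNumber M.γ μ L)) * ((1 / 2) ^ (k / epochLen M.γ) * B)) ∧
      (∀ ε > 0, Integrable (fun ω => f (π (epochLen M.γ * epochs B ε) ω) - f πs) ℙ ∧
        ∫ ω, (f (π (epochLen M.γ * epochs B ε) ω) - f πs) ∂ℙ ≤ ε)) ∧
    AdmissibleSteps M.γ μ L (leastSteps M.γ μ L) ∧
    (∀ ε > 0, (gradEvals (leastSteps M.γ μ L) (epochLen M.γ * epochs B ε) : ℝ)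
      ≤ 20 * (epochLen M.γ * epochs B ε) * Real.sqrt (condNumber M.γ μ L)
        * (epochs B ε + Real.log (condNumber M.γ μ L / (M.γ * (1 - M.γ) ^ 2)))) ∧
    (fun ε : ℝ => (gradEvals (leastSteps M.γ μ L) (epochLen M.γ * epochs B ε) : ℝ))
      =O[𝓝[>] 0] (fun ε : ℝ => Real.logb M.γ ε * Real.sqrt (condNumber M.γ μ L)
        * Real.log (1 / ε)) := by
  subst hf
  have hγ := M.γ_pos
  have hγ1 := M.γ_lt_one
  obtain ⟨s₀⟩ := nonempty_of_mem_stdSimplex hνs.1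
  have := nonempty_of_mem_stdSimplex (hπs.1 s₀)
  have hB0 : 0 < B := hB ▸ rateConst_pos hγ hγ1 hμ (hπs.gap_uniformPolicy_nonneg hνs.1) _
  have hc := div_pos hμ (sub_pos.2 hγ1)
  have hm := subModulus_pos hγ hμ
  refine ⟨fun R ℱ T Qhat π v x y hS hT hrun hR hadapted hest => ?_,
    admissibleSteps_leastSteps hγ hγ1 hμ, fun ε _ => gradEvals_le hγ hγ1 hμ (epochs B ε),
    isBigO_gradEvals hγ hγ1 hμ hB0⟩
  have H := isStochasticPMD_of_isInexactSPMD hμ hL hh hS hT hrun hR hadapted hest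
  have hv (ω : Ω) : v 0 ω = uniformPolicy S A := (hrun ω).v_zero
  exact ⟨fun k => ⟨H.integrable_potential hc hh.continuousOn hπs.1 k,
      H.integral_potential_le hμ hh.continuousOn hv hπs hνs hB k,
      H.integrable_potential_self hc (updateError_nonneg hγ hγ1 hμ _ 0)
        (sqrt_div_pos hm four_mul_subModulus_le)
        ((sqrt_div_le_half hm four_mul_subModulus_le).trans (by norm_num)) hh.continuousOn hπs.1
        hνs.1 k,
      H.integral_policy_potential_le hμ hh.continuousOn hv hπs hνs hB k⟩,
    fun ε hε => ⟨(H.integrable_objective hh.continuousOn _).sub (integrable_const _),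
      H.integral_gap_le hμ hh.continuousOn hv hπs hνs hB hε⟩⟩
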